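/- Let $q$ be a prime power and let $\mathbb F_{q^4}/\mathbb F_q$ be the extension of degree $m=4$. An $[n,k]_{q^4/q}$ code is a $k$-dimensional $\mathbb F_{q^4}$-subspace $\mathcal C$ of $\mathbb F_{q^4}^n$. For $v\in\mathbb F_{q^4}^n$ let $\mathrm{wt}_{\mathrm{rk}}(v)=\dim_{\mathbb F_q}\langle v_1,\dots,v_n\rangle_{\mathbb F_q}$, and let $\mathrm{supp}(v)\subseteq\mathbb F_q^n$ be the row space of the matrix $A$ over $\mathbb F_q$ with $v=uA$, where $u$ is an $\mathbb F_q$-basis of $\langle v_1,\dots,v_n\rangle_{\mathbb F_q}$. The code $\mathcal C$ is minimal if for all $v\in\mathcal C\setminus\{0\}$ and $u\in\mathcal C$ one has $\mathrm{supp}(u)\subseteq\mathrm{supp}(v)$ if and only if $u=\lambda v$ for some $\lambda\in\mathbb F_{q^4}$. It is MRD if $k\ge 1$ and $mk=\min\{m(n-d+1),\,n(m-d+1)\}$, where $m=4$ and $d$ is the minimum of $\mathrm{wt}_{\mathrm{rk}}$ on $\mathcal C\setminus\{0\}$. Two codes of length $n$ are equivalent if one is obtained from the other by right multiplication by a matrix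 in $\mathrm{GL}(n,q)$. The direct sum of codes is the set of all concatenations of their codewords. Let $$U=\{(x,y,x^q+y^{q^2},x^{q^2}+y^q+y^{q^2}) : x,y\in\mathbb F_{q^4}\}\subseteq\mathbb F_{q^4}^4 .$$ A code $\mathcal C\subseteq\mathbb F_{q^4}^8$ is associated to $U$ if there are $A\in\mathrm{GL}(4,q^4)$ and vectors $u_1,\dots,u_8$ with $\langle u_1,\dots,u_8\rangle_{\mathbb F_q}=UA$ such that $\mathcal C$ is equivalent to the $\mathbb F_{q^4}$-row space of the matrix with columns $u_1,\dots,u_8$. (1) Suppose $q=2^h$ with $h$ odd. Then $U$ is an $[8,4]_{q^4/q}$ system, i.e. $\dim_{\mathbb F_q}U=8$ and $\langle U\rangle_{\mathbb F_{q^4}}=\mathbb F_{q^4}^4$, there is a code associated to $U$, and every code $\mathcal C$ associated to $U$ is an $[8,4]_{q^4/q}$ MRD code, is minimal, and is not equivalent to a direct sum of (finitely many) MRD codes all of length smaller than $8$. (2) For every prime power $q$, if $\mathcal D_1,\mathcal D_2$ are $[4,2]_{q^4/q}$ MRD codes, then $\mathcal D_1\oplus\mathcal D_2$ is not minimal. 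-/

import Mathlib

/-!
Throughout, `K` is the finite field with `q` elements and `L` is an extension field of `K` of
degree `m`.  A rank-metric code of length `n` is an `L`-subspace of `Fin n → L`.
-/

namespace RankMetric

section Codes

variable (K : Type*) {L : Type*} [Field K] [Field L] [Algebra K L]

/-- The rank weight of `v`: the `K`-dimension of the `K`-span of its entries. -/
noncomputable def rankWeight {n : ℕ} (v : Fin n → L) : ℕ :=
  Module.finrank K (Submodule.span K (Set.range v))

/-- The coordinate matrix `A` of `v` with respect to a `K`-basis `u` of the `K`-span of the entries
of `v`, i.e. the matrix with entries in `K` such that `v = u A`.  Its rows are indexed by `u`. -/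
noncomputable def coordMatrix {n : ℕ} {ι : Type*} (v : Fin n → L)
    (u : Module.Basis ι K (Submodule.span K (Set.range v))) : Matrix ι (Fin n) K :=
  fun j i => u.repr ⟨v i, Submodule.subset_span (Set.mem_range_self i)⟩ j

/-- The rank support of `v`: the row space of the matrix `A` over `K` such that `v = u A`, for a
basis `u` of the span of the entries of `v` (the row space does not depend on `u`). -/
noncomputable def rankSupport {n : ℕ} (v : Fin n → L) : Submodule K (Fin n → K) :=
  Submodule.span K (Set.range
    (coordMatrix K v (Module.Basis.ofVectorSpace K (Submodule.span K (Set.range v)))).row)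

/-- A code is minimal if each of its nonzero codewords `v` is minimal: the codewords whose support
is contained in that of `v` are exactly the `L`-multiples of `v`. -/
def IsMinimalCode {n : ℕ} (C : Submodule L (Fin n → L)) : Prop :=
  ∀ v ∈ C, v ≠ 0 → ∀ u ∈ C,
    (rankSupport K u ≤ rankSupport K v ↔ ∃ c : L, u = c • v)

/-- The minimum rank distance of a (nonzero) code. -/
noncomputable def minDist {n : ℕ} (C : Submodule L (Fin n → L)) : ℕ :=
  sInf {w : ℕ | ∃ c ∈ C, c ≠ 0 ∧ w = rankWeight K c}

/-- `C` is an `[n, k]` MRD code over `L / K`: a nonzero `k`-dimensional code of length `n` meeting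
the Singleton-like bound `m k ≤ min {m (n - d + 1), n (m - d + 1)}` with equality.  As `C ≠ 0`, its
minimum distance `d` is at most `n` and at most `m`, so the subtractions do not truncate. -/
def IsMRD (n k : ℕ) (C : Submodule L (Fin n → L)) : Prop :=
  0 < k ∧ Module.finrank L C = k ∧
    Module.finrank K L * k =
      min (Module.finrank K L * (n - minDist K C + 1))
        (n * (Module.finrank K L - minDist K C + 1))

/-- Linear equivalence of codes: `C₂ = C₁ A` for some `A ∈ GL(n, K)`. -/
def CodeEquiv {n : ℕ} (C₁ C₂ : Submodule L (Fin n → L)) : Prop :=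
  ∃ A : GL (Fin n) K,
    (C₂ : Set (Fin n → L)) =
      (fun v => Matrix.vecMul v ((A : Matrix (Fin n) (Fin n) K).map (algebraMap K L))) ''
        (C₁ : Set (Fin n → L))

/-- `U` is an `[n, k]` system over `L / K`. -/
def IsSystem (n k : ℕ) (U : Submodule K (Fin k → L)) : Prop :=
  Module.finrank K U = n ∧ Submodule.span L (U : Set (Fin k → L)) = ⊤

/-- Linear equivalence of systems: `U₂ = U₁ A` for some `A ∈ GL(k, L)`. -/
def SystemEquiv {k : ℕ} (U₁ U₂ : Submodule K (Fin k → L)) : Prop :=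
  ∃ A : GL (Fin k) L,
    (U₂ : Set (Fin k → L)) =
      (fun u => Matrix.vecMul u (A : Matrix (Fin k) (Fin k) L)) '' (U₁ : Set (Fin k → L))

/-- The row space over `L` of the matrix whose columns are `u 0, …, u (n - 1)`. -/
def codeOfColumns {n k : ℕ} (u : Fin n → Fin k → L) : Submodule L (Fin n → L) :=
  Submodule.span L (Set.range (Matrix.of u).transpose.row)

/-- The code `C` of length `n` is associated to the `[n, k]` system `U`: there are vectors
`u 0, …, u (n - 1)` spanning over `K` a system equivalent to `U`, such that `C` is equivalent to the
row space of the matrix with columns `u 0, …, u (n - 1)`. -/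
def IsAssociated {n k : ℕ} (C : Submodule L (Fin n → L)) (U : Submodule K (Fin k → L)) : Prop :=
  ∃ u : Fin n → Fin k → L,
    SystemEquiv K U (Submodule.span K (Set.range u)) ∧ CodeEquiv K (codeOfColumns u) C

end Codes

/-- The direct sum of codes `D 0, …, D (t - 1)` of lengths `n 0, …, n (t - 1)`, of total length `N`:
all concatenations `(d 0 | … | d (t - 1))` with `d i ∈ D i`. -/
def directSum {L : Type*} [Field L] {t N : ℕ} {n : Fin t → ℕ} (hN : ∑ i, n i = N)
    (D : (i : Fin t) → Submodule L (Fin (n i) → L)) : Submodule L (Fin N → L) where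
  carrier := {v | ∀ i, (fun j => v (Fin.cast hN (finSigmaFinEquiv ⟨i, j⟩))) ∈ D i}
  zero_mem' := fun i => (D i).zero_mem
  add_mem' := fun ha hb i => (D i).add_mem (ha i) (hb i)
  smul_mem' := fun c _ ha i => (D i).smul_mem c (ha i)

/-- The `K`-subspace
`U = {(x, y, x ^ q + y ^ (q ^ 2), x ^ (q ^ 2) + y ^ q + y ^ (q ^ 2)) : x, y ∈ L}` of `L ^ 4`, where
`q` is the number of elements of `K`. -/
def systemU (K L : Type*) [Field K] [Fintype K] [Field L] [Algebra K L] :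
    Submodule K (Fin 4 → L) where
  carrier := {v | ∃ x y : L, v =
    ![x, y, x ^ Fintype.card K + y ^ Fintype.card K ^ 2,
      x ^ Fintype.card K ^ 2 + y ^ Fintype.card K + y ^ Fintype.card K ^ 2]}
  zero_mem' := by
    refine ⟨0, 0, ?_⟩
    have h : Fintype.card K ≠ 0 := Fintype.card_ne_zero
    ext i
    fin_cases i <;> simp [h]
  add_mem' := by
    rintro _ _ ⟨x, y, rfl⟩ ⟨x', y', rfl⟩
    have h (a b : L) : (a + b) ^ Fintype.card K = a ^ Fintype.card K + b ^ Fintype.card K :=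
      map_add (FiniteField.frobeniusAlgHom K L) a b
    refine ⟨x + x', y + y', ?_⟩
    ext i
    fin_cases i <;> simp [pow_two, pow_mul, h] <;> ring
  smul_mem' := by
    rintro c _ ⟨x, y, rfl⟩
    have h (a : L) : (c • a) ^ Fintype.card K = c • a ^ Fintype.card K :=
      map_smul (FiniteField.frobeniusAlgHom K L) c a
    refine ⟨c • x, c • y, ?_⟩
    ext i
    fin_cases i <;> simp [pow_two, pow_mul, h]

end RankMetric

/-! ### Identities in characteristic two -/

/-! Write σ or φ for the `q`-Frobenius of `L`. If `g` spans `U` over `K`, the associated code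
consists of the words `(x ⬝ᵥ g j)_j` with `x ∈ L⁴`. The weight of such a word is the `K`-rank of the
form `x` restricted to `U`, and inclusion of supports becomes reversed inclusion of the hyperplane
sections `U ∩ x^⊥`. Part (1) thus rests on two properties of `U`.

Every nonzero form has rank at least 3 on `U` (`three_le_finrank_range_hyperplaneForm`), and rank 3
occurs. Hence `d = 3`, and `4 * 4 = 8 * (4 - 3 + 1)` is the MRD equality. Also, `U` meets every
`L`-subspace of dimension 2 in `K`-dimension at most 3 (`finrank_le_three_of_systemMap_section`). A
hyperplane section has dimension at least `8 - 4 = 4`, so it lies in only one hyperplane, and the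
code is minimal. Both properties reduce, by comparing coefficients of `q`-polynomials, to the
impossibility of small systems of equations in characteristic two. Oddness of `h` enters only
through `hω`: the primitive cube roots of unity are not fixed by σ.

For direct sums, `d ≥ 3` and total dimension 4 in length 8 force a `[4,2]` MRD summand
(`exists_isMRD_four_two_of_directSum`). Such a summand has a word of rank 4, whose support contains
that of every other word of the summand, so the sum is not minimal. The last argument is also part
(2). -/

section CharTwo

variable {R F : Type*} [CommRing R] [Field F] [Algebra R F] [CharP F 2] {σ : F →ₐ[R] F}

/-- The map `t ↦ 1 / (t + 1)` has order 3 in characteristic two, while σ has order dividing 4. So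
`t` is fixed by σ, hence a primitive cube root of unity, against `hω`. -/
theorem false_of_map_mul_add_one_eq_one (hσ : ∀ x, σ (σ (σ (σ x))) = x)
    (hω : ∀ t, t ^ 2 + t + 1 = 0 → σ t = t + 1) {t : F} (ht : σ t * (t + 1) = 1) : False := by
  have h2 : (2 : F) = 0 := CharTwo.two_eq_zero
  have h1 := congrArg σ ht
  have h3 := congrArg σ h1
  simp only [map_mul, map_add, map_one] at h1 h3
  have e1 : σ (σ t) * t = t + 1 := by
    linear_combination (t + 1) * h1 - σ (σ t) * ht - (σ (σ t)) * h2
  have e2 : σ (σ (σ t)) = t := by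
    linear_combination t * h3 - σ (σ (σ t)) * e1 - (σ (σ (σ t))) * t * h2
  have e3 : t = σ t := by
    have := congrArg σ e2
    rwa [hσ] at this
  have e4 := hω t (by rw [← e3] at ht; linear_combination ht + h2)
  rw [← e3] at e4
  simp at e4

/-- The equations compare the coefficients of σ`y`, σ²`y`, σ³`y` when `x = p₀ y + p₁ σy + p₂ σ²y +
p₃ σ³y` is substituted into the two relations of `finrank_le_three_of_graph`. The coefficients of
`y` itself would only determine `β` and `δ`. -/
theorem false_of_graph_system (hσ : ∀ x, σ (σ (σ (σ x))) = x)
    (hω : ∀ t, t ^ 2 + t + 1 = 0 → σ t = t + 1) {α γ p₀ p₁ p₂ p₃ : F}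
    (h₀ : σ p₀ = α * p₁) (h₁ : σ p₁ = α * p₂ + 1) (h₂ : σ p₂ = α * p₃)
    (k₀ : σ (σ p₀) = γ * p₂ + 1) (k₁ : σ (σ p₁) = γ * p₃) (k₃ : σ (σ p₃) = γ * p₁ + 1) :
    False := by
  have c2 : (2 : F) = 0 := CharTwo.two_eq_zero
  have e1 : (α * σ α + γ) * p₃ = 1 := by
    have := congrArg σ h₁
    rw [k₁] at this
    simp only [map_mul, map_add, map_one, h₂] at this
    linear_combination this + (α * σ α * p₃) * c2
  have hp₃ : p₃ ≠ 0 := by rintro rfl; simp at e1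
  have e2 : p₂ = p₃ * (1 + σ α) := by
    have := congrArg σ h₀
    rw [k₀] at this
    simp only [map_mul, h₁] at this
    linear_combination (-p₂) * e1 + p₃ * this + p₃ * (α * σ α * p₂ - 1) * c2
  have e3 : σ p₃ * (1 + σ (σ α)) = α * p₃ := by
    rw [← h₂, e2]; simp
  have g : γ * p₃ = 1 + α * σ α * p₃ := by linear_combination e1 - α * σ α * p₃ * c2
  have e4 : p₁ = 1 + σ (σ α) * σ (σ (σ α)) * σ (σ p₃) := by
    have := congrArg (fun x => σ (σ x)) (k₁.trans g)
    simpa [hσ] using this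
  have m1 : p₃ * σ (σ p₃) + p₃ =
      (1 + α * σ α * p₃) * (1 + σ (σ α) * σ (σ (σ α)) * σ (σ p₃)) := by
    rw [← e4]
    linear_combination p₃ * k₃ + p₁ * g + p₃ * c2
  have m2 := congrArg (fun x => σ (σ x)) m1
  simp only [map_mul, map_add, map_one, hσ] at m2
  -- σ² swaps the two factors on the right of `m1` and fixes `p₃ * σ (σ p₃)`, so only the lone `p₃`
  -- changes.
  have hP : σ (σ p₃) = p₃ := by linear_combination m2 - m1
  rw [hP] at m1
  have f1 := congrArg σ e3
  have f2 := congrArg σ f1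
  simp only [map_mul, map_add, map_one, hP, hσ] at f1 f2
  have q1 : α * σ α = (1 + σ (σ α)) * (1 + σ (σ (σ α))) := by
    apply mul_right_cancel₀ hp₃
    linear_combination -(σ α) * e3 - (1 + σ (σ α)) * f1
  have q2 : (α + σ (σ α)) * (1 + α + σ (σ α)) = 0 := by
    apply mul_right_cancel₀ hp₃
    linear_combination -(1 + α) * e3 + (1 + σ (σ α)) * f2 + (α * σ (σ α) * p₃) * c2 +
      (σ (σ α) + σ (σ α) ^ 2) * p₃ * c2
  rcases mul_eq_zero.mp q2 with q3 | q3
  · have a2 : σ (σ α) = α := by linear_combination q3 - α * c2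
    simp only [a2] at *
    have a1 : σ α = 1 + α := by linear_combination q1 + σ α * c2
    rw [a1] at m1
    have hκ : σ (α * p₃) = α * p₃ := by rw [map_mul, a1]; linear_combination e3
    have n1 : (α * p₃) ^ 2 + α * (α * p₃) = α ^ 2 + α ^ 2 * (1 + α) ^ 2 * (α * p₃) ^ 2 := by
      linear_combination α ^ 2 * m1 + α ^ 3 * (1 + α) * p₃ * c2
    generalize α * p₃ = κ at hκ n1
    have n2 := congrArg σ n1
    simp only [map_mul, map_add, map_one, map_pow, hκ, a1] at n2
    have n3 : κ = 1 := by
      linear_combination n2 - n1 + (α * κ ^ 2 * 6 + α ^ 2 * κ ^ 2 * 6 + α ^ 3 * κ ^ 2 * 2 + 2 * κ ^ 2 + α) * c2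
    subst n3
    -- `α ^ 2 + α` is a primitive cube root of unity, yet σ fixes it because `σ α = 1 + α`.
    have n4 := hω (α ^ 2 + α) (by linear_combination n1 + (2 * α ^ 2 + 2 * α ^ 3 + α ^ 4) * c2)
    simp only [map_add, map_pow, a1] at n4
    exact one_ne_zero (α := F) (by linear_combination n4 - α * c2)
  · have a2 : σ (σ α) = 1 + α := by linear_combination q3 - (1 + α) * c2
    have hα : α ≠ 0 := by
      rintro rfl
      simp at a2
    have P1 : σ p₃ = p₃ := by
      apply mul_left_cancel₀ hα
      rw [a2] at e3
      linear_combination e3 - σ p₃ * c2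
    rw [a2, map_add, map_one] at m1
    have n1 : p₃ ^ 2 * (1 + α * σ α * (1 + α) * (1 + σ α)) = 1 + (α + σ α) * p₃ := by
      linear_combination m1 + p₃ * α * σ α * (1 + p₃ + p₃ * σ α + p₃ * α + p₃ * α * σ α) * c2
    have n2 := congrArg σ n1
    simp only [map_mul, map_add, map_one, map_pow, a2, P1] at n2
    have n3 : p₃ * 1 = p₃ * 0 := by
      linear_combination n1 - n2 +
        p₃ ^ 2 * σ α * (α + α * σ α + 1 + σ α) * c2
    simp [hp₃] at n3

/-- The system left by the degenerate case of `finrank_le_three_of_graph`, with `η` normal to a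
hyperplane of `L` for the trace form and `θ` the inverse of `φ x₀`. The proof eliminates `α` and
`β`, then plays each relation against its conjugates. -/
theorem false_of_hyperplane_system (hσ : ∀ x, σ (σ (σ (σ x))) = x) {α β η θ k : F}
    (hη : η ≠ 0) (hθ : θ ≠ 0) (hk : σ k = k)
    (h₁ : (σ β + 1) * σ (σ (σ η)) = σ η) (h₂ : (σ α + 1) * σ (σ (σ η)) = σ (σ η))
    (h₃ : σ α * σ θ = θ) (h₄ : β * θ + σ (σ θ) = k * η) : False := by
  have c2 : (2 : F) = 0 := CharTwo.two_eq_zero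
  have hη1 : σ η ≠ 0 := by simpa using hη
  have hη2 : σ (σ η) ≠ 0 := by simpa using hη
  have hη3 : σ (σ (σ η)) ≠ 0 := by simpa using hη
  have b : (β + 1) * σ (σ η) = η := by
    have := congrArg (fun x => σ (σ (σ x))) h₁
    simpa [hσ] using this
  have u0 : (η + σ (σ η)) * θ + σ (σ η) * σ (σ θ) = k * η * σ (σ η) := by
    linear_combination σ (σ η) * h₄ - θ * b + (σ (σ η)) * θ * c2
  have u2 := congrArg (fun x => σ (σ x)) u0
  simp only [map_mul, map_add, hσ, hk] at u2
  have r : η * σ (σ θ) = σ (σ η) * θ := by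
    linear_combination u2 - u0
  have r1 := congrArg σ r
  have g0 : θ * σ (σ (σ η)) = σ θ * (σ (σ η) + σ (σ (σ η))) := by
    linear_combination σ θ * h₂ - σ (σ (σ η)) * h₃ - σ (σ (σ η)) * σ θ * c2
  have g2 := congrArg (fun x => σ (σ x)) g0
  simp only [map_mul, map_add, hσ] at g2 r1
  have t0 : θ * (η ^ 2 + η * σ (σ η) + σ (σ η) ^ 2) = k * η ^ 2 * σ (σ η) := by
    linear_combination η * u0 - σ (σ η) * r
  have t1 := congrArg σ t0
  simp only [map_mul, map_add, map_pow, hk] at t1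
  -- `r`, `g0` and their conjugates are linear in the conjugates of `θ`; eliminating these leaves a
  -- condition on `η` alone, which factors.
  have E : (σ η * σ (σ η) + η * σ (σ (σ η))) *
      (σ η * σ (σ η) + η * σ (σ (σ η)) + σ η * σ (σ (σ η))) = 0 := by
    apply mul_right_cancel₀ hθ
    linear_combination -(σ η ^ 2 * (σ (σ η) + σ (σ (σ η)))) * r +
      σ η * η * (σ (σ η) + σ (σ (σ η))) * g2 +
      η * (η + σ η) * (σ (σ η) + σ (σ (σ η))) * r1 - η * (η + σ η) * σ (σ (σ η)) * g0 +
      η * σ (σ (σ η)) * (η * σ (σ (σ η)) + σ η * σ (σ (σ η)) + σ η * σ (σ η)) * θ * c2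
  rcases mul_eq_zero.mp E with h | h
  · have h' := congrArg σ h
    simp only [map_mul, map_add, hσ, map_zero] at h'
    have h2 : σ (σ η) = η := by
      have : (σ (σ η) + η) ^ 2 = 0 := by
        apply mul_right_cancel₀ (mul_ne_zero hη1 hη3)
        linear_combination η * σ η * h - σ η * σ (σ η) * h' +
          (σ (σ η) ^ 2 + η * σ (σ η)) * σ η * σ (σ (σ η)) * c2
      have := pow_eq_zero_iff (two_ne_zero) |>.mp this
      linear_combination this - η * c2
    rw [h2] at t0 g0
    have hk' : θ = k * η := by
      apply mul_right_cancel₀ (pow_ne_zero 2 hη)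
      linear_combination t0 - θ * η ^ 2 * c2
    rw [hk', map_mul, hk] at g0
    have : k * σ η * σ η = 0 := by linear_combination -g0
    rw [hk'] at hθ
    simp_all
  · have h5 : θ * σ η = σ θ * η := by
      apply mul_right_cancel₀ hη3
      linear_combination σ η * g0 + σ θ * h - σ (σ (σ η)) * σ θ * η * c2
    have h6 : (η * σ η + σ (σ η) * σ (σ (σ η))) * (η * σ (σ (σ η)) + σ η * σ (σ η)) = 0 := by
      apply mul_right_cancel₀ (mul_ne_zero hθ hη1)
      linear_combination σ η ^ 2 * σ (σ (σ η)) * t0 - η * σ (σ η) * (η * t1 +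
        (σ η ^ 2 + σ η * σ (σ (σ η)) + σ (σ (σ η)) ^ 2) * h5) +
        θ * σ η * η * σ (σ η) * (σ η ^ 2 + σ (σ (σ η)) ^ 2) * c2
    have h7 : η * σ (σ (σ η)) + σ η * σ (σ η) ≠ 0 := by
      intro h8
      exact mul_ne_zero hη1 hη3 (by linear_combination h - h8)
    have h9 := (mul_eq_zero.mp h6).resolve_right h7
    have h10 := congrArg σ h9
    simp only [map_mul, map_add, hσ, map_zero] at h10
    exact h7 (by linear_combination h10)

end CharTwo

/-! ### Linearized polynomials over finite fields -/

section Linearized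

variable {K L : Type*} [Field K] [Fintype K] [Field L] [Algebra K L]

local notation "φ" => FiniteField.frobeniusAlgHom K L

open Polynomial in
-- The sum is a polynomial of degree below `q ^ n` with at least `q ^ n` roots.
theorem linearized_coeff_eq_zero [FiniteDimensional K L] {n : ℕ} (c : Fin n → L)
    (W : Submodule K L) (hW : n ≤ Module.finrank K W)
    (h : ∀ z ∈ W, ∑ i, c i * z ^ Fintype.card K ^ (i : ℕ) = 0) : c = 0 := by
  classical
  have := Module.finite_of_finite K (M := L)
  have := Fintype.ofFinite L
  have hq : 1 < Fintype.card K := Fintype.one_lt_card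
  have hinj := Nat.pow_right_injective hq
  set P : L[X] := ∑ i, C (c i) * X ^ Fintype.card K ^ (i : ℕ) with hP
  have hdeg : P.natDegree < Fintype.card K ^ n := by
    rcases Nat.eq_zero_or_pos n with rfl | hn
    · simp [hP]
    refine lt_of_le_of_lt (natDegree_sum_le_of_forall_le (n := Fintype.card K ^ (n - 1)) _ _
      fun i _ => ?_) (Nat.pow_lt_pow_right hq (by omega))
    exact (natDegree_C_mul_X_pow_le _ _).trans (Nat.pow_le_pow_right hq.le (by omega))
  have hzero : P = 0 := by
    refine eq_zero_of_natDegree_lt_card_of_eval_eq_zero' P (Finset.univ.filter (· ∈ W)) ?_ ?_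
    · intro z hz
      simpa [hP, eval_finsetSum] using h z (by simpa using hz)
    · refine hdeg.trans_le ?_
      rw [← Fintype.card_subtype]
      have := Module.card_eq_pow_finrank (K := K) (V := W)
      rw [this]
      exact Nat.pow_le_pow_right hq.le hW
  funext j
  have hj := congrArg (fun p => coeff p (Fintype.card K ^ (j : ℕ))) hzero
  simp only [hP, finsetSum_coeff, coeff_C_mul, coeff_X_pow, coeff_zero] at hj
  rw [Finset.sum_eq_single j] at hj
  · simpa using hj
  · intro i _ hij
    rw [if_neg, mul_zero]
    intro e
    exact hij (Fin.ext (hinj e).symm)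
  · simp

theorem linearized_coeff_eq_zero₂ [FiniteDimensional K L] {c₀ c₁ : L}
    (W : Submodule K L) (hW : 2 ≤ Module.finrank K W)
    (h : ∀ z ∈ W, c₀ * z + c₁ * φ z = 0) : c₀ = 0 ∧ c₁ = 0 := by
  have := linearized_coeff_eq_zero ![c₀, c₁] W hW fun z hz => by
    simpa [Fin.sum_univ_succ] using h z hz
  simpa using this

theorem linearized_coeff_eq_zero₃ [FiniteDimensional K L] {c₀ c₁ c₂ : L}
    (W : Submodule K L) (hW : 3 ≤ Module.finrank K W)
    (h : ∀ z ∈ W, c₀ * z + c₁ * φ z + c₂ * φ (φ z) = 0) : c₀ = 0 ∧ c₁ = 0 ∧ c₂ = 0 := by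
  have := linearized_coeff_eq_zero ![c₀, c₁, c₂] W hW fun z hz => by
    simpa [Fin.sum_univ_succ, ← pow_mul, pow_succ, ← add_assoc] using h z hz
  simpa using this

theorem linearized_coeff_eq_zero₄ [FiniteDimensional K L] {c₀ c₁ c₂ c₃ : L}
    (W : Submodule K L) (hW : 4 ≤ Module.finrank K W)
    (h : ∀ z ∈ W, c₀ * z + c₁ * φ z + c₂ * φ (φ z) + c₃ * φ (φ (φ z)) = 0) :
    c₀ = 0 ∧ c₁ = 0 ∧ c₂ = 0 ∧ c₃ = 0 := by
  have := linearized_coeff_eq_zero ![c₀, c₁, c₂, c₃] W hW fun z hz => by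
    simpa [Fin.sum_univ_succ, ← pow_mul, pow_succ, ← add_assoc] using h z hz
  simpa using this

theorem trace_frobenius [FiniteDimensional K L] (x : L) :
    Algebra.trace K L (φ x) = Algebra.trace K L x :=
  Algebra.trace_eq_of_algEquiv (FiniteField.frobeniusAlgEquivOfAlgebraic K L) x

theorem frobenius_surjective [FiniteDimensional K L] : Function.Surjective φ :=
  (FiniteField.frobeniusAlgEquivOfAlgebraic K L).surjective

theorem frobenius_four (hm : Module.finrank K L = 4) (x : L) : φ (φ (φ (φ x))) = x := by
  have := Module.finite_of_finrank_pos (R := K) (M := L) (by omega)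
  have := Module.finite_of_finite K (M := L)
  have h : φ ^ 4 = 1 := by
    rw [← hm, ← FiniteField.orderOf_frobeniusAlgHom K L, pow_orderOf_eq_one]
  exact DFunLike.congr_fun h x

theorem trace_eq_sum_frobenius (hm : Module.finrank K L = 4) (x : L) :
    algebraMap K L (Algebra.trace K L x) = x + φ x + φ (φ x) + φ (φ (φ x)) := by
  have := Module.finite_of_finrank_pos (R := K) (M := L) (by omega)
  have := Module.finite_of_finite K (M := L)
  rw [FiniteField.algebraMap_trace_eq_sum_pow, hm]
  simp [Finset.sum_range_succ, ← pow_mul, pow_succ]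

theorem eq_zero_of_trace_mul [FiniteDimensional K L] {a : L}
    (h : ∀ x, Algebra.trace K L (x * a) = 0) : a = 0 :=
  have := Module.finite_of_finite K (M := L)
  (traceForm_nondegenerate K L).2 a h

theorem finrank_trace_orthogonal [FiniteDimensional K L] (W : Submodule K L) :
    Module.finrank K ((Algebra.traceForm K L).orthogonal W) =
      Module.finrank K L - Module.finrank K W :=
  have := Module.finite_of_finite K (M := L)
  LinearMap.BilinForm.finrank_orthogonal (traceForm_nondegenerate K L) W

/-- This is the trace adjoint of `x ↦ a x + b φ x + c φ² x`, with φ² applied to clear the inverse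
Frobenius maps. -/
theorem trace_adjoint [FiniteDimensional K L] {a b c z : L}
    (h : ∀ x, Algebra.trace K L ((a * x + b * φ x + c * φ (φ x)) * z) = 0) :
    φ (φ a) * φ (φ z) + φ b * φ z + c * z = 0 := by
  apply eq_zero_of_trace_mul (K := K)
  intro y
  obtain ⟨x', rfl⟩ := frobenius_surjective (K := K) y
  obtain ⟨x, rfl⟩ := frobenius_surjective (K := K) x'
  have e₁ : Algebra.trace K L (φ (φ x) * (φ (φ a) * φ (φ z))) = Algebra.trace K L (a * x * z) := by
    rw [← trace_frobenius (a * x * z), ← trace_frobenius (φ (a * x * z))]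
    simp only [map_mul]; congr 1; ring
  have e₂ : Algebra.trace K L (φ (φ x) * (φ b * φ z)) = Algebra.trace K L (b * φ x * z) := by
    rw [← trace_frobenius (b * φ x * z)]
    simp only [map_mul]; congr 1; ring
  rw [mul_add, mul_add, map_add, map_add, e₁, e₂, ← h x, ← map_add, ← map_add]
  congr 1; ring

/-- Here `q = 2 * 4 ^ k` and `t ^ 4 = t`, so `t ^ q = t ^ 2 = t + 1`. -/
theorem frobenius_eq_add_one {h : ℕ} (ho : Odd h) (hc : Fintype.card K = 2 ^ h) [CharP L 2]
    {t : L} (ht : t ^ 2 + t + 1 = 0) : φ t = t + 1 := by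
  have c2 : (2 : L) = 0 := CharTwo.two_eq_zero
  have h4 : t ^ 4 = t := by
    linear_combination (t ^ 2 - t) * ht
  have hk : ∀ k : ℕ, t ^ 4 ^ k = t := by
    intro k
    induction k with
    | zero => simp
    | succ k ih => rw [pow_succ, pow_mul, ih, h4]
  obtain ⟨k, rfl⟩ := ho
  rw [FiniteField.coe_frobeniusAlgHom]
  simp only [hc]
  rw [pow_succ, pow_mul 2 2 k, pow_mul t]
  norm_num [hk]
  linear_combination ht - (t + 1) * c2

theorem charP_two_of_card {h : ℕ} (hc : Fintype.card K = 2 ^ h) : CharP L 2 := by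
  have : CharP K 2 := by
    obtain ⟨p, hp⟩ := CharP.exists K
    obtain ⟨n, hpp, hn⟩ := FiniteField.card K p
    have : p ∣ 2 ^ h := by rw [← hc, hn]; exact dvd_pow_self _ n.ne_zero
    have := (Nat.prime_dvd_prime_iff_eq hpp Nat.prime_two).mp (hpp.dvd_of_dvd_pow this)
    exact this ▸ hp
  exact charP_of_injective_algebraMap (algebraMap K L).injective 2

end Linearized

/-! ### The subspace `U` and two-dimensional subspaces -/

section Evasive

variable {K L : Type*} [Field K] [Fintype K] [Field L] [Algebra K L]

local notation "φ" => FiniteField.frobeniusAlgHom K L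

theorem finrank_le_three_of_graph (hm : Module.finrank K L = 4) [CharP L 2]
    (hω : ∀ t : L, t ^ 2 + t + 1 = 0 → φ t = t + 1) (V : Submodule K (L × L)) {α β γ δ : L}
    (h₁ : ∀ p ∈ V, φ p.1 + φ (φ p.2) = α * p.1 + β * p.2)
    (h₂ : ∀ p ∈ V, φ (φ p.1) + φ p.2 + φ (φ p.2) = γ * p.1 + δ * p.2) :
    Module.finrank K V ≤ 3 := by
  have := Module.finite_of_finrank_pos (R := K) (M := L) (by omega)
  have c2 : (2 : L) = 0 := CharTwo.two_eq_zero
  have hσ := frobenius_four (K := K) (L := L) hm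
  by_contra! hV
  -- Applying φ to the first relation and eliminating `φ x` and `φ² x` expresses `ε x`, with `ε = α
  -- φ(α) + γ`, as a monic `q`-polynomial of `q`-degree 3 in `y`.
  have key : ∀ p ∈ V, (α * φ α + γ) * p.1 =
      (δ + φ α * β) * p.2 + (φ β + 1) * φ p.2 + (φ α + 1) * φ (φ p.2) + φ (φ (φ p.2)) := by
    intro p hp
    have e := congrArg φ (h₁ p hp)
    simp only [map_add, map_mul] at e
    linear_combination e - h₂ p hp + φ α * h₁ p hp +
      (φ α * α * p.1 - φ (φ (φ p.2)) - φ (φ p.2) * φ α - p.2 * δ) * c2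
  -- If `ε = 0`, the image of `f` has dimension at most 3 and its kernel at most 1, so both bounds
  -- are attained. If `ε ≠ 0`, `f` is bijective and `V` is the graph of a `q`-polynomial.
  set f : V →ₗ[K] L := (LinearMap.snd K L L).domRestrict V with hf
  have hrk := f.finrank_range_add_finrank_ker
  by_cases hε : α * φ α + γ = 0
  · have key' : ∀ y ∈ LinearMap.range f, (δ + φ α * β) * y + (φ β + 1) * φ y +
        (φ α + 1) * φ (φ y) + 1 * φ (φ (φ y)) = 0 := by
      rintro _ ⟨p, rfl⟩
      have := key p.1 p.2
      rw [hε, zero_mul] at this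
      rw [one_mul]
      exact this.symm
    have hY : Module.finrank K (LinearMap.range f) ≤ 3 := by
      by_contra! hY
      exact one_ne_zero (linearized_coeff_eq_zero₄ _ hY key').2.2.2
    obtain ⟨x₀, hx₀, hα⟩ : ∃ x₀ : L, x₀ ≠ 0 ∧ φ x₀ = α * x₀ := by
      have hN : 0 < Module.finrank K (LinearMap.ker f) := by omega
      obtain ⟨⟨⟨x, y⟩, hp⟩, hk, hne⟩ := Submodule.exists_mem_ne_zero_of_ne_bot
        (p := LinearMap.ker f) (by rintro h; rw [h, finrank_bot] at hN; exact hN.ne rfl)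
      have hy : y = 0 := hk
      subst hy
      refine ⟨x, ?_, by simpa using h₁ _ hp⟩
      rintro rfl
      exact hne rfl
    have hN : Module.finrank K (LinearMap.ker f) ≤ 1 := by
      set g : LinearMap.ker f →ₗ[K] L :=
        (LinearMap.fst K L L).comp (V.subtype.comp (LinearMap.ker f).subtype) with hg
      have hginj : Function.Injective g := by
        rintro ⟨⟨⟨x, y⟩, hp⟩, hk⟩ ⟨⟨⟨x', y'⟩, hp'⟩, hk'⟩ h
        have e : x = x' := h
        have e1 : y = 0 := hk
        have e2 : y' = 0 := hk'
        subst e e1 e2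
        rfl
      rw [← LinearMap.finrank_range_of_inj hginj]
      by_contra! hN
      refine one_ne_zero (linearized_coeff_eq_zero₂ (c₀ := -α) (c₁ := 1) _ hN ?_).2
      rintro _ ⟨⟨⟨⟨x, y⟩, hp⟩, hk⟩, rfl⟩
      have e1 : y = 0 := hk
      subst e1
      have := h₁ _ hp
      simp only [map_zero, mul_zero, add_zero] at this
      simp [hg, this]
    have hY3 : Module.finrank K (LinearMap.range f) = 3 := by omega
    have horth := finrank_trace_orthogonal (LinearMap.range f)
    rw [hm, hY3] at horth
    obtain ⟨⟨η, hη⟩, hη0, hspan⟩ := finrank_eq_one_iff'.mp horth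
    replace hη0 : η ≠ 0 := fun h => hη0 (Subtype.ext h)
    have hη3 : φ (φ (φ η)) ≠ 0 := by simpa using hη0
    have htr : ∀ y ∈ LinearMap.range f, η * y + φ η * φ y + φ (φ η) * φ (φ y) +
        φ (φ (φ η)) * φ (φ (φ y)) = 0 := by
      intro y hy
      have h0 : Algebra.trace K L (y * η) = 0 := hη y hy
      have := trace_eq_sum_frobenius (K := K) hm (y * η)
      rw [h0, map_zero] at this
      simp only [map_mul] at this
      linear_combination -this
    -- Two `q`-polynomials of `q`-degree 3 vanish on the same hyperplane, so they are proportional.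
    have hcoef := linearized_coeff_eq_zero₃ _ hY3.ge fun y hy => by
      have e : ((δ + φ α * β) * φ (φ (φ η)) - η) * y + ((φ β + 1) * φ (φ (φ η)) - φ η) * φ y +
        ((φ α + 1) * φ (φ (φ η)) - φ (φ η)) * φ (φ y) = 0 := by
        linear_combination φ (φ (φ η)) * key' y hy - htr y hy
      exact e
    have hφx : φ x₀ ≠ 0 := by simpa using hx₀
    have hα0 : α ≠ 0 := by rintro rfl; simp_all
    -- Divide the first relation by `φ x₀ = α x₀` and take traces: the `x`-terms become `φ (s / x₀)`
    -- and `s / x₀`, which have equal trace. Moving φ² across the trace form uses `φ⁴ = 1`.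
    have h4 : β * (φ x₀)⁻¹ + φ (φ (φ x₀)⁻¹) ∈ (Algebra.traceForm K L).orthogonal
        (LinearMap.range f) := by
      rintro _ ⟨⟨⟨s, y⟩, hp⟩, rfl⟩
      change Algebra.trace K L (y * (β * (φ x₀)⁻¹ + φ (φ (φ x₀)⁻¹))) = 0
      have e1 : Algebra.trace K L (y * φ (φ (φ x₀)⁻¹)) =
          Algebra.trace K L (φ (φ y) * (φ x₀)⁻¹) := by
        rw [← trace_frobenius (φ (φ y) * _), ← trace_frobenius (φ (φ (φ y) * _)), map_mul φ,
          map_mul φ, hσ]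
      have e2 : Algebra.trace K L (φ s * (φ x₀)⁻¹) =
          Algebra.trace K L (s * x₀⁻¹) := by
        rw [← trace_frobenius (s * _), map_mul φ, map_inv₀ φ]
      have e3 : s * x₀⁻¹ = α * s * (φ x₀)⁻¹ := by
        rw [hα]; field_simp
      have e4 := h₁ _ hp
      simp only at e4
      rw [e3] at e2
      rw [mul_add, map_add, e1, ← map_add, ← sub_eq_zero.mpr e2, ← map_sub]
      congr 1
      linear_combination (φ x₀)⁻¹ * e4 + (α * s + β * y - φ s) * (φ x₀)⁻¹ * c2
    obtain ⟨k, hk⟩ := hspan ⟨_, h4⟩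
    have hk' : β * (φ x₀)⁻¹ + φ (φ (φ x₀)⁻¹) = algebraMap K L k * η := by
      rw [← Algebra.smul_def]
      exact (congrArg Subtype.val hk).symm
    refine false_of_hyperplane_system (σ := φ) hσ (α := α) (β := β) (η := η)
      (θ := (φ x₀)⁻¹) (k := algebraMap K L k) hη0 (inv_ne_zero hφx) (AlgHom.commutes φ _)
      (sub_eq_zero.mp hcoef.2.1) (sub_eq_zero.mp hcoef.2.2) ?_ hk'
    change φ α * φ (φ x₀)⁻¹ = _
    rw [map_inv₀, hα, map_mul, hα]
    have : φ α ≠ 0 := by simpa using hα0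
    field_simp
  · have hinj : LinearMap.ker f = ⊥ := by
      rw [LinearMap.ker_eq_bot']
      rintro ⟨⟨x, y⟩, hp⟩ hk
      have hy : y = 0 := hk
      subst hy
      have e := key _ hp
      simp only [map_zero, mul_zero, add_zero] at e
      have := (mul_eq_zero.mp e).resolve_left hε
      subst this
      rfl
    rw [hinj, finrank_bot, add_zero] at hrk
    have htop : LinearMap.range f = ⊤ := Submodule.eq_top_of_finrank_eq (by
      have := (LinearMap.range f).finrank_le
      omega)
    have hgraph : ∀ y : L, ∃ x, (x, y) ∈ V := by
      intro y
      have : y ∈ LinearMap.range f := htop ▸ Submodule.mem_top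
      obtain ⟨⟨⟨x, y'⟩, hp⟩, rfl⟩ := this
      exact ⟨x, hp⟩
    set e := (α * φ α + γ)⁻¹ with he
    set p₀ := e * (δ + φ α * β)
    set p₁ := e * (φ β + 1)
    set p₂ := e * (φ α + 1)
    have hp : ∀ y, ((p₀ * y + p₁ * φ y + p₂ * φ (φ y) + e * φ (φ (φ y))), y) ∈ V := by
      intro y
      obtain ⟨x, hx⟩ := hgraph y
      convert hx
      have := key _ hx
      have h' : x = e * ((α * φ α + γ) * x) := by rw [he]; field_simp
      rw [h', this]
      simp only [p₀, p₁, p₂]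
      ring
    have r₁ := linearized_coeff_eq_zero₄ (⊤ : Submodule K L) (by rw [finrank_top, hm])
      (c₀ := φ e - α * p₀ - β) (c₁ := φ p₀ - α * p₁)
      (c₂ := φ p₁ - α * p₂ + 1) (c₃ := φ p₂ - α * e) fun y _ => by
        have := h₁ _ (hp y)
        simp only [map_add, map_mul, hσ] at this
        linear_combination this
    have r₂ := linearized_coeff_eq_zero₄ (⊤ : Submodule K L) (by rw [finrank_top, hm])
      (c₀ := φ (φ p₂) - γ * p₀ - δ) (c₁ := φ (φ e) - γ * p₁ + 1)
      (c₂ := φ (φ p₀) - γ * p₂ + 1) (c₃ := φ (φ p₁) - γ * e) fun y _ => by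
        have := h₂ _ (hp y)
        simp only [map_add, map_mul, hσ] at this
        linear_combination this
    exact false_of_graph_system (σ := φ) hσ hω (α := α) (γ := γ)
      (p₀ := p₀) (p₁ := p₁) (p₂ := p₂) (p₃ := e) (sub_eq_zero.mp r₁.2.1)
      (by linear_combination r₁.2.2.1 - c2) (sub_eq_zero.mp r₁.2.2.2)
      (by linear_combination r₂.2.2.1 - c2) (sub_eq_zero.mp r₂.2.2.2)
      (by linear_combination r₂.2.1 - c2)

end Evasive

/-! ### Hyperplane sections of the system `U` -/

namespace RankMetric

section SystemU

variable (K : Type*) {L : Type*} [Field K] [Fintype K] [Field L] [Algebra K L]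

local notation "φ" => FiniteField.frobeniusAlgHom K L

/-- The parametrization of `systemU K L` by `L × L`. -/
def systemMap : L × L →ₗ[K] Fin 4 → L where
  toFun p := ![p.1, p.2, φ p.1 + φ (φ p.2), φ (φ p.1) + φ p.2 + φ (φ p.2)]
  map_add' p p' := by
    ext i
    fin_cases i <;> simp only [Prod.fst_add, Prod.snd_add, map_add] <;> simp <;> ring
  map_smul' c p := by
    ext i
    fin_cases i <;> simp only [Prod.smul_fst, Prod.smul_snd, map_smul] <;> simp

theorem range_systemMap : LinearMap.range (systemMap K (L := L)) = systemU K L := by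
  ext v
  have h (p : L × L) : systemMap K p =
      ![p.1, p.2, p.1 ^ Fintype.card K + p.2 ^ Fintype.card K ^ 2,
        p.1 ^ Fintype.card K ^ 2 + p.2 ^ Fintype.card K + p.2 ^ Fintype.card K ^ 2] := by
    simp [systemMap, pow_two, pow_mul]
  constructor
  · rintro ⟨p, rfl⟩
    exact ⟨p.1, p.2, h p⟩
  · rintro ⟨x, y, rfl⟩
    exact ⟨(x, y), h (x, y)⟩

theorem systemMap_injective : Function.Injective (systemMap K (L := L)) := by
  intro p p' h
  exact Prod.ext (congrFun h 0) (congrFun h 1)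

/-- The `K`-linear map whose kernel is the section of the system `U` with the hyperplane `x ⬝ᵥ v = 0`
of `L ^ 4`. -/
def hyperplaneForm (x : Fin 4 → L) : L × L →ₗ[K] L where
  toFun p := x ⬝ᵥ systemMap K p
  map_add' p p' := by rw [map_add, dotProduct_add]
  map_smul' c p := by rw [map_smul, dotProduct_smul]; rfl

theorem hyperplaneForm_apply (x : Fin 4 → L) (p : L × L) :
    hyperplaneForm K x p = x 0 * p.1 + x 1 * p.2 + x 2 * (φ p.1 + φ (φ p.2)) +
      x 3 * (φ (φ p.1) + φ p.2 + φ (φ p.2)) := by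
  change x ⬝ᵥ systemMap K p = _
  rw [dotProduct, Fin.sum_univ_four]
  rfl

variable {K}

/-- Rank at most 2 leaves a trace-orthogonal space `W` of dimension at least 2, on which two adjoint
`q`-polynomials vanish. -/
theorem three_le_finrank_range_hyperplaneForm (hm : Module.finrank K L = 4) [CharP L 2]
    (hω : ∀ t : L, t ^ 2 + t + 1 = 0 → φ t = t + 1) {x : Fin 4 → L} (hx : x ≠ 0) :
    3 ≤ Module.finrank K (LinearMap.range (hyperplaneForm K x)) := by
  have := Module.finite_of_finrank_pos (R := K) (M := L) (by omega)
  have hσ := frobenius_four (K := K) (L := L) hm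
  by_contra! hr
  set W := (Algebra.traceForm K L).orthogonal (LinearMap.range (hyperplaneForm K x)) with hWdef
  have hW : 2 ≤ Module.finrank K W := by
    have := finrank_trace_orthogonal (LinearMap.range (hyperplaneForm K x))
    rw [← hWdef] at this
    omega
  have h₁ : ∀ z ∈ W, φ (φ (x 0)) * φ (φ z) + φ (x 2) * φ z + x 3 * z = 0 := by
    intro z hz
    apply trace_adjoint (K := K)
    intro s
    have : Algebra.trace K L (hyperplaneForm K x (s, 0) * z) = 0 := hz _ ⟨(s, 0), rfl⟩
    simpa only [hyperplaneForm_apply, map_zero, mul_zero, add_zero] using this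
  have h₂ : ∀ z ∈ W, φ (φ (x 1)) * φ (φ z) + φ (x 3) * φ z + (x 2 + x 3) * z = 0 := by
    intro z hz
    apply trace_adjoint (K := K)
    intro s
    have : Algebra.trace K L (hyperplaneForm K x (0, s) * z) = 0 := hz _ ⟨(0, s), rfl⟩
    rw [← this, hyperplaneForm_apply]
    simp only [map_zero, mul_zero, zero_add]
    congr 1; ring
  -- Eliminating the `z`-term from `h₁` and `h₂` leaves a combination of `φ z` and `φ² z`. The outer
  -- `φ³ = φ⁻¹` lowers it to `q`-degree 1, so it has no nonzero instance vanishing on `W`.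
  have h₃ := linearized_coeff_eq_zero₂ (c₀ := φ (φ (φ ((x 2 + x 3) * φ (x 2) - x 3 * φ (x 3)))))
    (c₁ := φ (φ (φ ((x 2 + x 3) * φ (φ (x 0)) - x 3 * φ (φ (x 1)))))) W hW fun z hz => by
      rw [← hσ z]
      simp only [← map_mul, ← map_add]
      simp only [map_eq_zero]
      linear_combination (x 2 + x 3) * h₁ z hz - x 3 * h₂ z hz
  simp only [map_eq_zero] at h₃
  by_cases h3 : x 3 = 0
  · have h2 : x 2 = 0 := by simpa [h3] using h₃.1
    have h0 := (linearized_coeff_eq_zero₂ (c₀ := x 0) (c₁ := 0) W hW fun z hz => by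
      have := h₁ z hz
      simp only [h2, h3, map_zero, zero_mul, add_zero, ← map_mul, map_eq_zero] at this
      simpa using this).1
    have h1 := (linearized_coeff_eq_zero₂ (c₀ := x 1) (c₁ := 0) W hW fun z hz => by
      have := h₂ z hz
      simp only [h2, h3, map_zero, zero_mul, add_zero, ← map_mul, map_eq_zero] at this
      simpa using this).1
    apply hx
    ext i
    fin_cases i <;> assumption
  · have : φ (x 3) ≠ 0 := by simpa using h3
    refine false_of_map_mul_add_one_eq_one (σ := φ) hσ hω (t := x 2 / x 3) ?_
    rw [map_div₀ φ]
    field_simp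
    linear_combination h₃.1

theorem exists_finrank_range_hyperplaneForm_le (hm : Module.finrank K L = 4) [CharP L 2] :
    ∃ x : Fin 4 → L, x ≠ 0 ∧
      Module.finrank K (LinearMap.range (hyperplaneForm K x)) ≤ 3 := by
  have := Module.finite_of_finrank_pos (R := K) (M := L) (by omega)
  -- For this form every monomial pairs with one of equal trace, so all values have trace 0 in
  -- characteristic two.
  refine ⟨![0, 1, 1, 1], fun h => by simpa using congrFun h 1, ?_⟩
  set W := (Algebra.traceForm K L).orthogonal
    (LinearMap.range (hyperplaneForm K (![0, 1, 1, 1] : Fin 4 → L))) with hW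
  have h1 : (1 : L) ∈ W := by
    rintro _ ⟨p, rfl⟩
    change Algebra.trace K L (_ * 1) = 0
    have e : hyperplaneForm K (![0, 1, 1, 1] : Fin 4 → L) p * 1 =
        (φ p.1 + φ (φ p.1)) + (p.2 + φ p.2) + (φ (φ p.2) + φ (φ p.2)) := by
      rw [hyperplaneForm_apply]
      simp
      ring
    have c2 (a : K) : a + a = 0 := by
      apply (algebraMap K L).injective
      rw [map_add, map_zero, CharTwo.add_self_eq_zero]
    rw [e]
    simp only [map_add (Algebra.trace K L), trace_frobenius, c2]
  have h2 := finrank_trace_orthogonal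
    (LinearMap.range (hyperplaneForm K (![0, 1, 1, 1] : Fin 4 → L)))
  have h3 : Module.finrank K W ≠ 0 := by
    intro h
    rw [Submodule.finrank_eq_zero] at h
    rw [h] at h1
    exact one_ne_zero ((Submodule.mem_bot K).mp h1)
  rw [← hW] at h2
  omega

theorem finrank_le_three_of_systemMap_section_of_eq_zero (hm : Module.finrank K L = 4) [CharP L 2]
    (hω : ∀ t : L, t ^ 2 + t + 1 = 0 → φ t = t + 1) (V : Submodule K (L × L)) {x y : Fin 4 → L}
    (hxy : ∀ c d : L, c • x + d • y = 0 → c = 0 ∧ d = 0) (hx2 : x 2 = 0) (hx3 : x 3 = 0)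
    (hx : ∀ p ∈ V, hyperplaneForm K x p = 0) (hy : ∀ p ∈ V, hyperplaneForm K y p = 0) :
    Module.finrank K V ≤ 3 := by
  have := Module.finite_of_finrank_pos (R := K) (M := L) (by omega)
  have c2 : (2 : L) = 0 := CharTwo.two_eq_zero
  have hσ := frobenius_four (K := K) (L := L) hm
  by_contra! hV
  set a := x 0 with ha
  set b := x 1 with hb
  have hab : ¬ (a = 0 ∧ b = 0) := by
    rintro ⟨h0, h1⟩
    have : x = 0 := by ext i; fin_cases i <;> assumption
    exact one_ne_zero (hxy 1 0 (by simp [this])).1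
  -- `g` parametrizes the line `a x + b y = 0`; no sign is needed in characteristic two. By
  -- dimension `V` is the whole line.
  set g : L →ₗ[K] L × L := LinearMap.prod (LinearMap.mulLeft K b) (LinearMap.mulLeft K a) with hg
  have hle : V ≤ LinearMap.range g := by
    intro p hp
    have h := hx p hp
    rw [hyperplaneForm_apply, hx2, hx3] at h
    by_cases ha0 : a = 0
    · have hb0 : b ≠ 0 := fun h => hab ⟨ha0, h⟩
      refine ⟨p.1 / b, Prod.ext ?_ ?_⟩
      · simp [hg]; field_simp
      · have : b * p.2 = 0 := by
          rw [← ha, ← hb, ha0] at h; linear_combination h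
        simp [hg, ha0, (mul_eq_zero.mp this).resolve_left hb0]
    · refine ⟨p.2 / a, Prod.ext ?_ ?_⟩
      · simp [hg]
        field_simp
        linear_combination -h + b * p.2 * c2
      · simp [hg]; field_simp
  have hVr : V = LinearMap.range g := Submodule.eq_of_le_of_finrank_le hle (by
    have := LinearMap.finrank_range_le g
    omega)
  have hl : ∀ l : L, hyperplaneForm K y (b * l, a * l) = 0 := by
    intro l
    apply hy
    rw [hVr]
    exact ⟨l, rfl⟩
  have hc := linearized_coeff_eq_zero₃ (c₀ := y 0 * b + y 1 * a)
    (c₁ := y 2 * φ b + y 3 * φ a) (c₂ := y 2 * φ (φ a) + y 3 * (φ (φ b) + φ (φ a)))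
    (⊤ : Submodule K L) (by rw [finrank_top]; omega) fun l _ => by
      have := hl l
      rw [hyperplaneForm_apply] at this
      simp only [map_mul] at this
      linear_combination this
  obtain ⟨k₀, k₁, k₂⟩ := hc
  by_cases hy23 : y 2 = 0 ∧ y 3 = 0
  · have e₀ := hxy (-y 0) a (by
      ext i
      fin_cases i <;> simp [hx2, hx3, hy23, ← ha, ← hb]
      · ring
      · linear_combination k₀ - y 0 * b * c2)
    have e₁ := hxy (-y 1) b (by
      ext i
      fin_cases i <;> simp [hx2, hx3, hy23, ← ha, ← hb]
      · linear_combination k₀ - y 1 * a * c2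
      · ring)
    exact hab ⟨e₀.2, e₁.2⟩
  -- `(y 2, y 3)` is a nonzero solution of the linear system `k₁`, `k₂`, so its determinant
  -- vanishes.
  · have hdet : φ (b * φ (a + b) - a * φ a) = 0 := by
      simp only [map_sub, map_mul, map_add]
      by_cases h2 : y 2 = 0
      · have h3 : y 3 ≠ 0 := fun h => hy23 ⟨h2, h⟩
        apply mul_left_cancel₀ h3
        linear_combination φ b * k₂ - φ (φ a) * k₁
      · apply mul_left_cancel₀ h2
        linear_combination (φ (φ a) + φ (φ b)) * k₁ - φ a * k₂
    rw [map_eq_zero] at hdet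
    have hb0 : b ≠ 0 := by
      intro h
      have : a * φ a = 0 := by rw [h] at hdet; linear_combination -hdet
      rcases mul_eq_zero.mp this with h' | h'
      · exact hab ⟨h', h⟩
      · exact hab ⟨(map_eq_zero φ).mp h', h⟩
    have : φ b ≠ 0 := by simpa using hb0
    refine false_of_map_mul_add_one_eq_one (σ := φ) hσ hω (t := a / b) ?_
    rw [map_div₀ φ]
    field_simp
    rw [map_add] at hdet
    linear_combination -hdet + b * φ a * c2

/-- Either the two equations can be solved for the last two coordinates by Cramer's rule, or some
combination of them involves only the first two. -/
theorem finrank_le_three_of_systemMap_section (hm : Module.finrank K L = 4) [CharP L 2]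
    (hω : ∀ t : L, t ^ 2 + t + 1 = 0 → φ t = t + 1) (V : Submodule K (L × L)) {x y : Fin 4 → L}
    (hxy : ∀ c d : L, c • x + d • y = 0 → c = 0 ∧ d = 0)
    (hx : ∀ p ∈ V, hyperplaneForm K x p = 0) (hy : ∀ p ∈ V, hyperplaneForm K y p = 0) :
    Module.finrank K V ≤ 3 := by
  have c2 : (2 : L) = 0 := CharTwo.two_eq_zero
  by_cases hD : x 2 * y 3 - x 3 * y 2 = 0
  · by_cases h : x 2 = 0 ∧ x 3 = 0
    · exact finrank_le_three_of_systemMap_section_of_eq_zero hm hω V hxy h.1 h.2 hx hy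
    · obtain ⟨c, hc₂, hc₃⟩ : ∃ c, y 2 = c * x 2 ∧ y 3 = c * x 3 := by
        by_cases h2 : x 2 = 0
        · have h3 : x 3 ≠ 0 := fun h' => h ⟨h2, h'⟩
          have : x 3 * y 2 = 0 := by linear_combination -hD + y 3 * h2
          refine ⟨y 3 / x 3, ?_, by field_simp⟩
          rw [h2, (mul_eq_zero.mp this).resolve_left h3, mul_zero]
        · refine ⟨y 2 / x 2, by field_simp, ?_⟩
          field_simp
          linear_combination hD
      refine finrank_le_three_of_systemMap_section_of_eq_zero hm hω V (x := y - c • x) (y := x)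
        ?_ (by simp [hc₂]) (by simp [hc₃]) ?_ hx
      · intro d e h
        have := hxy (e - d * c) d (by rw [← h]; module)
        exact ⟨this.2, by linear_combination this.1 + c * this.2⟩
      · intro p hp
        have h₁ := hx p hp
        have h₂ := hy p hp
        rw [hyperplaneForm_apply] at *
        simp only [Pi.sub_apply, Pi.smul_apply, smul_eq_mul]
        linear_combination h₂ - c * h₁
  · set D := x 2 * y 3 - x 3 * y 2 with hDdef
    refine finrank_le_three_of_graph hm hω V
      (α := (x 3 * y 0 - y 3 * x 0) / D) (β := (x 3 * y 1 - y 3 * x 1) / D)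
      (γ := (y 2 * x 0 - x 2 * y 0) / D) (δ := (y 2 * x 1 - x 2 * y 1) / D) ?_ ?_
    · intro p hp
      have h₁ := hx p hp
      have h₂ := hy p hp
      rw [hyperplaneForm_apply] at h₁ h₂
      apply mul_left_cancel₀ hD
      have : D * ((x 3 * y 0 - y 3 * x 0) / D * p.1 + (x 3 * y 1 - y 3 * x 1) / D * p.2) =
        (x 3 * y 0 - y 3 * x 0) * p.1 + (x 3 * y 1 - y 3 * x 1) * p.2 := by field_simp
      rw [this, hDdef]
      linear_combination y 3 * h₁ - x 3 * h₂
    · intro p hp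
      have h₁ := hx p hp
      have h₂ := hy p hp
      rw [hyperplaneForm_apply] at h₁ h₂
      apply mul_left_cancel₀ hD
      have : D * ((y 2 * x 0 - x 2 * y 0) / D * p.1 + (y 2 * x 1 - x 2 * y 1) / D * p.2) =
        (y 2 * x 0 - x 2 * y 0) * p.1 + (y 2 * x 1 - x 2 * y 1) * p.2 := by field_simp
      rw [this, hDdef]
      linear_combination x 2 * h₂ - y 2 * h₁

theorem exists_smul_of_ker_hyperplaneForm_le (hm : Module.finrank K L = 4) [CharP L 2]
    (hω : ∀ t : L, t ^ 2 + t + 1 = 0 → φ t = t + 1) {x y : Fin 4 → L} (hx : x ≠ 0)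
    (h : LinearMap.ker (hyperplaneForm K x) ≤ LinearMap.ker (hyperplaneForm K y)) :
    ∃ c : L, y = c • x := by
  have := Module.finite_of_finrank_pos (R := K) (M := L) (by omega)
  by_contra! hc
  have h₁ := finrank_le_three_of_systemMap_section hm hω (LinearMap.ker (hyperplaneForm K x))
    (x := x) (y := y) ?_ (fun p hp => hp) (fun p hp => h hp)
  · have h₂ := (hyperplaneForm K x).finrank_range_add_finrank_ker
    have h₃ := (LinearMap.range (hyperplaneForm K x)).finrank_le
    rw [Module.finrank_prod] at h₂
    omega
  · intro c d hcd
    have hd : d = 0 := by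
      by_contra hd
      refine hc (-(d⁻¹ * c)) ?_
      have : d⁻¹ • (c • x + d • y) = 0 := by rw [hcd, smul_zero]
      rw [smul_add, smul_smul, smul_smul, inv_mul_cancel₀ hd, one_smul] at this
      rw [neg_smul]
      exact eq_neg_of_add_eq_zero_right this
    subst hd
    simpa [hx] using hcd

end SystemU

end RankMetric

/-! ### Rank-metric codes -/

namespace RankMetric

section Codes

variable {K : Type*} {L : Type*} [Field K] [Field L] [Algebra K L]

theorem rankWeight_eq_finrank_range {n : ℕ} (v : Fin n → L) :
    rankWeight K v = Module.finrank K (LinearMap.range (Fintype.linearCombination K v)) := by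
  rw [Fintype.range_linearCombination, rankWeight]

theorem rankWeight_le {n : ℕ} (v : Fin n → L) : rankWeight K v ≤ n := by
  rw [rankWeight_eq_finrank_range]
  simpa using LinearMap.finrank_range_le (Fintype.linearCombination K v)

theorem finrank_ker_linearCombination {n : ℕ} (v : Fin n → L) :
    rankWeight K v + Module.finrank K (LinearMap.ker (Fintype.linearCombination K v)) = n := by
  rw [rankWeight_eq_finrank_range]
  simpa using (Fintype.linearCombination K v).finrank_range_add_finrank_ker

/-- The row space of `A` is the annihilator of the `K`-relations among the entries of `v`; this
turns support inclusion into reversed inclusion of kernels. -/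
theorem rankSupport_eq_map {n : ℕ} (v : Fin n → L) :
    rankSupport K v = (LinearMap.ker (Fintype.linearCombination K v)).dualAnnihilator.map
      (LinearEquiv.toLinearMap (Pi.basisFun K (Fin n)).dualBasis.equivFun) := by
  classical
  set S := Submodule.span K (Set.range v)
  have : FiniteDimensional K S := FiniteDimensional.span_of_finite K (Set.finite_range v)
  set b := Module.Basis.ofVectorSpace K S
  have := Module.Finite.finite_basis b
  have := Fintype.ofFinite (Module.Basis.ofVectorSpaceIndex K S)
  set f : (Fin n → K) →ₗ[K] S := Fintype.linearCombination K
    fun i => (⟨v i, Submodule.subset_span (Set.mem_range_self i)⟩ : S) with hf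
  have hker : LinearMap.ker (Fintype.linearCombination K v) = LinearMap.ker f := by
    ext κ
    simp [hf, Fintype.linearCombination_apply, Subtype.ext_iff]
  rw [hker, ← LinearMap.range_dualMap_eq_dualAnnihilator_ker, LinearMap.range_eq_map,
    ← b.dualBasis.span_eq, Submodule.map_span, Submodule.map_span, rankSupport]
  congr 1
  ext r
  simp only [Set.mem_range, Set.mem_image, exists_exists_eq_and]
  refine exists_congr fun j => ?_
  rw [iff_iff_eq]
  congr 1
  funext i
  simp [coordMatrix, Matrix.row, hf, b, S]

theorem rankSupport_le_iff {n : ℕ} (u v : Fin n → L) :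
    rankSupport K u ≤ rankSupport K v ↔
      LinearMap.ker (Fintype.linearCombination K v) ≤
        LinearMap.ker (Fintype.linearCombination K u) := by
  rw [rankSupport_eq_map, rankSupport_eq_map,
    Submodule.map_le_map_iff_of_injective (LinearEquiv.injective _),
    Subspace.dualAnnihilator_le_dualAnnihilator_iff]

theorem rankSupport_smul_le {n : ℕ} (c : L) (v : Fin n → L) :
    rankSupport K (c • v) ≤ rankSupport K v := by
  rw [rankSupport_le_iff]
  intro κ hκ
  rw [LinearMap.mem_ker, Fintype.linearCombination_apply] at *
  have : ∑ i, κ i • (c • v) i = c * ∑ i, κ i • v i := by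
    rw [Finset.mul_sum]
    exact Finset.sum_congr rfl fun i _ => by simp
  rw [this, hκ, mul_zero]

theorem minDist_le_rankWeight {n : ℕ} {C : Submodule L (Fin n → L)} {c : Fin n → L} (hc : c ∈ C)
    (h0 : c ≠ 0) : minDist K C ≤ rankWeight K c :=
  Nat.sInf_le ⟨c, hc, h0, rfl⟩

theorem exists_rankWeight_eq_minDist {n : ℕ} {C : Submodule L (Fin n → L)} (hC : C ≠ ⊥) :
    ∃ c ∈ C, c ≠ 0 ∧ rankWeight K c = minDist K C := by
  obtain ⟨c, hc, h0⟩ := Submodule.exists_mem_ne_zero_of_ne_bot hC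
  obtain ⟨c', hc', h0', h⟩ := Nat.sInf_mem
    (s := {w : ℕ | ∃ c ∈ C, c ≠ 0 ∧ w = rankWeight K c}) ⟨_, c, hc, h0, rfl⟩
  exact ⟨c', hc', h0', h.symm⟩

theorem IsMRD.ne_bot {n k : ℕ} {C : Submodule L (Fin n → L)} (h : IsMRD K n k C) : C ≠ ⊥ := by
  rintro rfl
  obtain ⟨h0, h1, -⟩ := h
  rw [finrank_bot] at h1
  omega

theorem CodeEquiv.trans {n : ℕ} {C₁ C₂ C₃ : Submodule L (Fin n → L)} (h₁ : CodeEquiv K C₁ C₂)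
    (h₂ : CodeEquiv K C₂ C₃) : CodeEquiv K C₁ C₃ := by
  obtain ⟨A, hA⟩ := h₁
  obtain ⟨B, hB⟩ := h₂
  refine ⟨A * B, ?_⟩
  rw [hB, hA, Set.image_image]
  simp [Matrix.vecMul_vecMul, Matrix.map_mul]

theorem CodeEquiv.refl {n : ℕ} (C : Submodule L (Fin n → L)) : CodeEquiv K C C :=
  ⟨1, by simp⟩

theorem linearCombination_dotProduct {n k : ℕ} (g : Fin n → Fin k → L) (x : Fin k → L) (κ : Fin n → K) :
    Fintype.linearCombination K (fun j => x ⬝ᵥ g j) κ =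
      x ⬝ᵥ Fintype.linearCombination K g κ := by
  simp only [Fintype.linearCombination_apply, dotProduct_sum, dotProduct_smul]

theorem mem_codeOfColumns {n k : ℕ} (u : Fin n → Fin k → L) (v : Fin n → L) :
    v ∈ codeOfColumns u ↔ ∃ x : Fin k → L, v = fun j => x ⬝ᵥ u j := by
  rw [codeOfColumns, Submodule.mem_span_range_iff_exists_fun]
  refine exists_congr fun x => ?_
  rw [eq_comm]
  refine Eq.congr_right ?_
  funext j
  simp [dotProduct, Matrix.row]

/-- Both equivalences can be absorbed into the columns: `A` changes only the parameter `x`, and `B`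
only the generators of `U`. -/
theorem IsAssociated.exists_columns {n k : ℕ} {C : Submodule L (Fin n → L)}
    {U : Submodule K (Fin k → L)} (h : IsAssociated K C U) :
    ∃ g : Fin n → Fin k → L, Submodule.span K (Set.range g) = U ∧ C = codeOfColumns g := by
  obtain ⟨u, ⟨A, hA⟩, ⟨B, hB⟩⟩ := h
  have hAA : (A : Matrix (Fin k) (Fin k) L) * (A⁻¹ : GL (Fin k) L) = 1 := by
    rw [← Units.val_mul, mul_inv_cancel]; rfl
  have hAA' : ((A⁻¹ : GL (Fin k) L) : Matrix (Fin k) (Fin k) L) * A = 1 := by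
    rw [← Units.val_mul, inv_mul_cancel]; rfl
  set w : Fin n → Fin k → L := fun i =>
    Matrix.vecMul (u i) ((A⁻¹ : GL (Fin k) L) : Matrix (Fin k) (Fin k) L) with hw
  have huw : ∀ i, Matrix.vecMul (w i) (A : Matrix (Fin k) (Fin k) L) = u i := by
    intro i
    rw [hw, Matrix.vecMul_vecMul, hAA', Matrix.vecMul_one]
  set g : Fin n → Fin k → L := fun j => ∑ i, (B : Matrix (Fin n) (Fin n) K) i j • w i with hg
  have hgB : Fintype.linearCombination K g =
      (Fintype.linearCombination K w).comp (B : Matrix (Fin n) (Fin n) K).mulVecLin := by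
    refine LinearMap.ext fun κ => ?_
    simp only [LinearMap.comp_apply, Fintype.linearCombination_apply, Matrix.mulVecLin_apply,
      Matrix.mulVec, dotProduct, hg, Finset.smul_sum, Finset.sum_smul, smul_smul]
    rw [Finset.sum_comm]
    simp only [mul_comm]
  refine ⟨g, ?_, ?_⟩
  · rw [← Fintype.range_linearCombination, hgB, LinearMap.range_comp_of_range_eq_top,
      Fintype.range_linearCombination]
    · have hwU : Set.range w = (Matrix.vecMulLinear ((A⁻¹ : GL (Fin k) L) :
          Matrix (Fin k) (Fin k) L)).restrictScalars K '' Set.range u := by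
        rw [← Set.range_comp]; rfl
      rw [hwU, ← Submodule.map_span]
      apply SetLike.coe_injective
      rw [Submodule.map_coe, hA, Set.image_image]
      simp [Matrix.vecMul_vecMul]
    · rw [LinearMap.range_eq_top]
      intro κ
      refine ⟨((B⁻¹ : GL (Fin n) K) : Matrix (Fin n) (Fin n) K).mulVec κ, ?_⟩
      simp [Matrix.mulVec_mulVec]
  · have hdot : ∀ (x : Fin k → L), Matrix.vecMul (fun j => x ⬝ᵥ u j)
        ((B : Matrix (Fin n) (Fin n) K).map (algebraMap K L)) =
        fun j => ((A : Matrix (Fin k) (Fin k) L).mulVec x) ⬝ᵥ g j := by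
      intro x
      funext j
      simp only [hg, dotProduct_sum, dotProduct_smul]
      change ∑ i, (x ⬝ᵥ u i) * algebraMap K L ((B : Matrix (Fin n) (Fin n) K) i j) = _
      refine Finset.sum_congr rfl fun i _ => ?_
      have : (A : Matrix (Fin k) (Fin k) L).mulVec x ⬝ᵥ w i = x ⬝ᵥ u i := by
        rw [← huw i, dotProduct_comm x, ← Matrix.dotProduct_mulVec, dotProduct_comm]
      rw [Algebra.smul_def, mul_comm]
      exact congrArg _ this.symm
    ext v
    rw [← SetLike.mem_coe, hB, mem_codeOfColumns]
    constructor
    · rintro ⟨c, hc, rfl⟩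
      obtain ⟨x, rfl⟩ := (mem_codeOfColumns u c).mp hc
      exact ⟨_, hdot x⟩
    · rintro ⟨x, rfl⟩
      refine ⟨fun j => Matrix.mulVec ((A⁻¹ : GL (Fin k) L) : Matrix (Fin k) (Fin k) L) x ⬝ᵥ u j,
        (mem_codeOfColumns u _).mpr ⟨_, rfl⟩, ?_⟩
      simp only [hdot, Matrix.mulVec_mulVec, hAA, Matrix.one_mulVec]

theorem isAssociated_codeOfColumns {n k : ℕ} {U : Submodule K (Fin k → L)}
    {g : Fin n → Fin k → L} (hg : Submodule.span K (Set.range g) = U) :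
    IsAssociated K (codeOfColumns g) U :=
  ⟨g, ⟨1, by simp [hg]⟩, CodeEquiv.refl _⟩

end Codes

end RankMetric

/-! ### Direct sums of MRD codes -/

namespace RankMetric

section DirectSum

variable {K : Type*} {L : Type*} [Field K] [Field L] [Algebra K L]

/-- The word of a direct sum whose component in the summand `i` is `c` and whose other components
vanish. -/
def directSumSingle {t N : ℕ} {n : Fin t → ℕ} (hN : ∑ i, n i = N) (i : Fin t)
    (c : Fin (n i) → L) : Fin N → L :=
  fun j => (Pi.single i c : (i : Fin t) → Fin (n i) → L)
    (finSigmaFinEquiv.symm (Fin.cast hN.symm j)).1 (finSigmaFinEquiv.symm (Fin.cast hN.symm j)).2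

theorem directSumSingle_apply {t N : ℕ} {n : Fin t → ℕ} (hN : ∑ i, n i = N) (i i' : Fin t)
    (c : Fin (n i) → L) (j : Fin (n i')) :
    directSumSingle hN i c (Fin.cast hN (finSigmaFinEquiv ⟨i', j⟩)) =
      (Pi.single i c : (i : Fin t) → Fin (n i) → L) i' j := by
  have : finSigmaFinEquiv.symm (Fin.cast hN.symm (Fin.cast hN (finSigmaFinEquiv ⟨i', j⟩))) =
      ⟨i', j⟩ := by
    simp only [Fin.cast_cast, Fin.cast_eq_self, Equiv.symm_apply_apply]
  rw [directSumSingle, this]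

theorem directSumSingle_mem {t N : ℕ} {n : Fin t → ℕ} (hN : ∑ i, n i = N)
    (D : (i : Fin t) → Submodule L (Fin (n i) → L)) {i : Fin t} {c : Fin (n i) → L}
    (hc : c ∈ D i) : directSumSingle hN i c ∈ directSum hN D := by
  intro i'
  simp only [directSumSingle_apply]
  by_cases h : i' = i
  · subst h
    simpa using hc
  · rw [Pi.single_eq_of_ne h]
    exact (D i').zero_mem

theorem linearCombination_directSumSingle {t N : ℕ} {n : Fin t → ℕ} (hN : ∑ i, n i = N)
    (i : Fin t) (c : Fin (n i) → L) :
    Fintype.linearCombination K (directSumSingle hN i c) =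
      (Fintype.linearCombination K c).comp
        (LinearMap.funLeft K K fun j => Fin.cast hN (finSigmaFinEquiv ⟨i, j⟩)) := by
  refine LinearMap.ext fun κ => ?_
  simp only [LinearMap.comp_apply, Fintype.linearCombination_apply, LinearMap.funLeft_apply]
  rw [← (finSigmaFinEquiv.trans (finCongr hN)).sum_comp, Fintype.sum_sigma]
  rw [Finset.sum_eq_single i]
  · refine Finset.sum_congr rfl fun j _ => ?_
    change _ • directSumSingle hN i c (Fin.cast hN (finSigmaFinEquiv ⟨i, j⟩)) = _
    rw [directSumSingle_apply, Pi.single_eq_same]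
    rfl
  · intro i' _ h
    refine Finset.sum_eq_zero fun j _ => ?_
    change _ • directSumSingle hN i c (Fin.cast hN (finSigmaFinEquiv ⟨i', j⟩)) = _
    rw [directSumSingle_apply, Pi.single_eq_of_ne h, Pi.zero_apply, smul_zero]
  · simp

theorem rankWeight_directSumSingle {t N : ℕ} {n : Fin t → ℕ} (hN : ∑ i, n i = N)
    (i : Fin t) (c : Fin (n i) → L) :
    rankWeight K (directSumSingle hN i c) = rankWeight K c := by
  rw [rankWeight_eq_finrank_range, rankWeight_eq_finrank_range,
    linearCombination_directSumSingle, LinearMap.range_comp_of_range_eq_top]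
  rw [LinearMap.range_eq_top]
  apply LinearMap.funLeft_surjective_of_injective
  intro j j' h
  simpa using h

theorem finrank_directSum_le {t N : ℕ} {n : Fin t → ℕ} (hN : ∑ i, n i = N)
    (D : (i : Fin t) → Submodule L (Fin (n i) → L)) :
    Module.finrank L (directSum hN D) ≤ ∑ i, Module.finrank L (D i) := by
  rw [← Module.finrank_pi_fintype]
  let f : directSum hN D →ₗ[L] (i : Fin t) → D i :=
    { toFun := fun v i => ⟨fun j => v.1 (Fin.cast hN (finSigmaFinEquiv ⟨i, j⟩)), v.2 i⟩
      map_add' := fun _ _ => rfl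
      map_smul' := fun _ _ => rfl }
  refine LinearMap.finrank_le_finrank_of_injective (f := f) fun v w h => ?_
  ext j
  obtain ⟨⟨i, j⟩, rfl⟩ := (finSigmaFinEquiv.trans (finCongr hN)).surjective j
  exact congrFun (congrArg Subtype.val (congrFun h i)) j

theorem linearCombination_smul_add {n : ℕ} (a b : L) (v w : Fin n → L) (κ : Fin n → K) :
    Fintype.linearCombination K (a • v + b • w) κ =
      a * Fintype.linearCombination K v κ + b * Fintype.linearCombination K w κ := by
  simp only [Fintype.linearCombination_apply, Finset.mul_sum, ← Finset.sum_add_distrib]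
  refine Finset.sum_congr rfl fun i _ => ?_
  simp [smul_add]

theorem eq_zero_of_linearCombination_eq_zero {C : Submodule L (Fin 4 → L)}
    (hd : ∀ c ∈ C, c ≠ 0 → 3 ≤ rankWeight K c) {v w : Fin 4 → L} (hv : v ∈ C) (hw : w ∈ C)
    (hvw : ∀ a b : L, a • v + b • w = 0 → a = 0 ∧ b = 0) {κ : Fin 4 → K}
    (hκv : Fintype.linearCombination K v κ = 0) (hκw : Fintype.linearCombination K w κ = 0) :
    κ = 0 := by
  by_contra hκ
  have htop : Submodule.span K {κ} = ⊤ := by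
    rw [eq_top_iff]
    intro κ' _
    -- Some nontrivial combination of `v` and `w` also satisfies the relation `κ'`. Its weight is at
    -- least 3, so its relations form a line, which contains both `κ` and `κ'`.
    obtain ⟨a, b, hab, h⟩ : ∃ a b : L, ¬ (a = 0 ∧ b = 0) ∧
        Fintype.linearCombination K (a • v + b • w) κ' = 0 := by
      by_cases h : Fintype.linearCombination K v κ' = 0
      · exact ⟨1, 0, by simp, by rw [linearCombination_smul_add, h]; ring⟩
      · exact ⟨Fintype.linearCombination K w κ', -Fintype.linearCombination K v κ',
          by simp [h], by rw [linearCombination_smul_add]; ring⟩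
    set c := a • v + b • w with hc
    have hcκ : Fintype.linearCombination K c κ = 0 := by
      rw [hc, linearCombination_smul_add, hκv, hκw]; ring
    have hwt := hd c (C.add_mem (C.smul_mem a hv) (C.smul_mem b hw)) fun h => hab (hvw a b h)
    have hker := finrank_ker_linearCombination (K := K) c
    obtain ⟨⟨ξ, hξ⟩, hspan⟩ := finrank_le_one_iff.mp
      (show Module.finrank K (LinearMap.ker (Fintype.linearCombination K c)) ≤ 1 by omega)
    obtain ⟨s, hs⟩ := hspan ⟨κ, hcκ⟩
    obtain ⟨s', hs'⟩ := hspan ⟨κ', h⟩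
    replace hs : s • ξ = κ := congrArg Subtype.val hs
    replace hs' : s' • ξ = κ' := congrArg Subtype.val hs'
    have hs0 : s ≠ 0 := by
      rintro rfl
      exact hκ (by rw [← hs, zero_smul])
    rw [Submodule.mem_span_singleton]
    exact ⟨s' * s⁻¹, by rw [← hs, smul_smul, mul_assoc, inv_mul_cancel₀ hs0, mul_one, hs']⟩
  have h1 := finrank_span_singleton (K := K) hκ
  rw [htop, finrank_top, Module.finrank_fin_fun] at h1
  omega

/-- Otherwise each of the `q ^ 4` words `v + l • w` has a nonzero relation in `K ^ 4`. Distinct `l`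
cannot share one, and there are only `q ^ 4 - 1`. -/
theorem exists_ker_linearCombination_eq_bot [Fintype K] (hm : Module.finrank K L = 4)
    {C : Submodule L (Fin 4 → L)} (hd : ∀ c ∈ C, c ≠ 0 → 3 ≤ rankWeight K c)
    {v w : Fin 4 → L} (hv : v ∈ C) (hw : w ∈ C)
    (hvw : ∀ a b : L, a • v + b • w = 0 → a = 0 ∧ b = 0) :
    ∃ l : L, LinearMap.ker (Fintype.linearCombination K (v + l • w)) = ⊥ := by
  have := Module.finite_of_finrank_pos (R := K) (M := L) (by omega)
  have := Module.finite_of_finite K (M := L)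
  have := Fintype.ofFinite L
  by_contra! hne
  choose κ hκ hκ0 using fun l => Submodule.exists_mem_ne_zero_of_ne_bot (hne l)
  have hinj : Function.Injective κ := by
    intro l m h
    by_contra hlm
    have h₁ := linearCombination_smul_add 1 l v w (κ l)
    have h₂ := linearCombination_smul_add 1 m v w (κ l)
    have h₃ : Fintype.linearCombination K (v + m • w) (κ l) = 0 := h ▸ hκ m
    rw [one_smul, LinearMap.mem_ker.mp (hκ l)] at h₁
    rw [one_smul, h₃] at h₂
    have hw0 : Fintype.linearCombination K w (κ l) = 0 := by
      apply mul_left_cancel₀ (sub_ne_zero.mpr hlm)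
      linear_combination h₂ - h₁
    have hv0 : Fintype.linearCombination K v (κ l) = 0 := by
      linear_combination -h₁ - l * hw0
    exact hκ0 l (eq_zero_of_linearCombination_eq_zero hd hv hw hvw hv0 hw0)
  classical
  have hbij := (Fintype.bijective_iff_injective_and_card κ).mpr ⟨hinj, by
    rw [Module.card_eq_pow_finrank (K := K) (V := L), hm]; simp⟩
  obtain ⟨l, hl⟩ := hbij.2 0
  exact hκ0 l hl

theorem IsMRD.three_le_rankWeight (hm : Module.finrank K L = 4) {C : Submodule L (Fin 4 → L)}
    (h : IsMRD K 4 2 C) {c : Fin 4 → L} (hc : c ∈ C) (h0 : c ≠ 0) : 3 ≤ rankWeight K c := by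
  refine le_trans ?_ (minDist_le_rankWeight hc h0)
  have := h.2.2
  rw [hm] at this
  omega

theorem IsMRD.exists_full_rank [Fintype K] (hm : Module.finrank K L = 4)
    {C : Submodule L (Fin 4 → L)} (h : IsMRD K 4 2 C) :
    ∃ v ∈ C, ∃ w ∈ C, LinearMap.ker (Fintype.linearCombination K v) = ⊥ ∧ v ≠ 0 ∧
      ∀ a : L, w ≠ a • v := by
  obtain ⟨b⟩ : Nonempty (Module.Basis (Fin 2) L C) := ⟨Module.finBasisOfFinrankEq L C h.2.1⟩
  have hli := b.linearIndependent.map' C.subtype C.ker_subtype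
  have hvec : C.subtype ∘ b = ![(b 0 : Fin 4 → L), (b 1 : Fin 4 → L)] := by
    funext i; fin_cases i <;> rfl
  rw [hvec] at hli
  have hb := LinearIndependent.pair_iff.mp hli
  obtain ⟨l, hl⟩ := exists_ker_linearCombination_eq_bot hm
    (fun c hc h0 => h.three_le_rankWeight hm hc h0) (b 0).2 (b 1).2 hb
  have hneq : ∀ a : L, (b 1 : Fin 4 → L) ≠ a • ((b 0 : Fin 4 → L) + l • (b 1 : Fin 4 → L)) := by
    intro a ha
    have e := hb a (a * l - 1) (by rw [sub_smul, one_smul, mul_smul, ← add_sub_assoc,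
      ← smul_add, ← ha, sub_self])
    have := e.2
    rw [e.1] at this
    simp at this
  refine ⟨_, C.add_mem (b 0).2 (C.smul_mem l (b 1).2), _, (b 1).2, hl, ?_, hneq⟩
  intro h0
  have := (hb 1 l (by rw [one_smul]; exact h0)).1
  exact one_ne_zero this

theorem directSumSingle_eq_smul {t N : ℕ} {n : Fin t → ℕ} (hN : ∑ i, n i = N) (i : Fin t)
    {v w : Fin (n i) → L} {a : L}
    (h : directSumSingle hN i w = a • directSumSingle hN i v) : w = a • v := by
  funext j
  have := congrFun h (Fin.cast hN (finSigmaFinEquiv ⟨i, j⟩))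
  simpa [directSumSingle_apply] using this

/-- With `d ≥ 3` the Singleton-like bound gives `2 k ≤ n` in each block, and summing forces
equality. So each length is even, at least 3 and below 8, that is 4 or 6, and 8 is not a multiple of
6. -/
theorem exists_isMRD_four_two_of_directSum (hm : Module.finrank K L = 4) {t : ℕ} {n k : Fin t → ℕ}
    (hn : ∑ i, n i = 8) (D : (i : Fin t) → Submodule L (Fin (n i) → L)) (hlt : ∀ i, n i < 8)
    (hD : ∀ i, IsMRD K (n i) (k i) (D i)) (hrk : Module.finrank L (directSum hn D) = 4)
    (hwt : ∀ c ∈ directSum hn D, c ≠ 0 → 3 ≤ rankWeight K c) : ∃ i, n i = 4 ∧ k i = 2 := by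
  have hd : ∀ i, 3 ≤ minDist K (D i) ∧ minDist K (D i) ≤ n i := by
    intro i
    obtain ⟨c, hc, h0, h⟩ := exists_rankWeight_eq_minDist (K := K) (hD i).ne_bot
    refine ⟨?_, h ▸ rankWeight_le c⟩
    rw [← h, ← rankWeight_directSumSingle (K := K) hn]
    refine hwt _ (directSumSingle_mem hn D hc) fun hz => h0 ?_
    simpa using directSumSingle_eq_smul hn i (v := c) (w := c) (a := 0) (by rw [hz]; simp)
  have hle : ∀ i, 2 * k i ≤ n i := by
    intro i
    have h := (hD i).2.2
    rw [hm] at h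
    have h' : n i * (4 - minDist K (D i) + 1) ≤ n i * 2 :=
      Nat.mul_le_mul_left _ (by have := (hd i).1; omega)
    omega
  have hsum : 4 ≤ ∑ i, k i := by
    rw [← hrk]
    exact (finrank_directSum_le hn D).trans (Finset.sum_le_sum fun i _ => (hD i).2.1.le)
  have heq : ∀ i, 2 * k i = n i := by
    have h2 : ∑ i, 2 * k i = ∑ i, n i := by
      have := Finset.sum_le_sum fun i (_ : i ∈ Finset.univ) => hle i
      rw [← Finset.mul_sum] at this ⊢
      omega
    exact fun i => (Finset.sum_eq_sum_iff_of_le fun i _ => hle i).mp h2 i (Finset.mem_univ i)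
  by_contra! hne
  have h6 : ∀ i, n i = 6 := by
    intro i
    have h₁ := hd i
    have h₂ := heq i
    have h₃ := hlt i
    by_contra h6
    exact hne i (by omega) (by omega)
  rw [Finset.sum_congr rfl fun i _ => h6 i] at hn
  simp at hn
  omega

theorem not_isMinimalCode_directSum [Fintype K] (hm : Module.finrank K L = 4) {t N : ℕ}
    {n : Fin t → ℕ} (hN : ∑ i, n i = N) (D : (i : Fin t) → Submodule L (Fin (n i) → L))
    (i : Fin t) (hn : n i = 4) (h : IsMRD K (n i) 2 (D i)) :
    ¬ IsMinimalCode K (directSum hN D) := by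
  intro hmin
  obtain ⟨v, hv, w, hw, hker, hv0, hvw⟩ : ∃ v ∈ D i, ∃ w ∈ D i,
      LinearMap.ker (Fintype.linearCombination K v) = ⊥ ∧ v ≠ 0 ∧ ∀ a : L, w ≠ a • v := by
    -- The type of `D i` depends on `n i`, so both are generalized before 4 is substituted.
    generalize D i = C at h
    generalize n i = m at hn C
    subst hn
    exact h.exists_full_rank hm
  obtain ⟨a, ha⟩ := (hmin _ (directSumSingle_mem hN D hv) (fun h0 => hv0 (by
      simpa using directSumSingle_eq_smul hN i (v := v) (w := v) (a := 0) (by rw [h0]; simp)))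
    _ (directSumSingle_mem hN D hw)).mp (by
      rw [rankSupport_le_iff, linearCombination_directSumSingle, linearCombination_directSumSingle,
        LinearMap.ker_comp, hker, LinearMap.ker_comp]
      exact Submodule.comap_mono bot_le)
  exact hvw a (directSumSingle_eq_smul hN i ha)

end DirectSum

end RankMetric

/-! ### Codes associated to the system `U` -/

namespace RankMetric

section Main

variable {K L : Type*} [Field K] [Fintype K] [Field L] [Algebra K L]

local notation "φ" => FiniteField.frobeniusAlgHom K L

theorem finrank_systemU (hm : Module.finrank K L = 4) : Module.finrank K (systemU K L) = 8 := by
  have := Module.finite_of_finrank_pos (R := K) (M := L) (by omega)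
  rw [← range_systemMap, LinearMap.finrank_range_of_inj (systemMap_injective K),
    Module.finrank_prod, hm]

theorem hyperplaneForm_ne_zero {x : Fin 4 → L}
    (h : 3 ≤ Module.finrank K (LinearMap.range (hyperplaneForm K x))) :
    ∃ p, hyperplaneForm K x p ≠ 0 := by
  by_contra! h0
  have : hyperplaneForm K x = 0 := LinearMap.ext h0
  rw [this, LinearMap.range_zero, finrank_bot] at h
  omega

theorem span_systemU (hm : Module.finrank K L = 4) [CharP L 2]
    (hω : ∀ t : L, t ^ 2 + t + 1 = 0 → φ t = t + 1) :
    Submodule.span L (systemU K L : Set (Fin 4 → L)) = ⊤ := by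
  by_contra h
  obtain ⟨f, hf0, hf⟩ := Submodule.exists_le_ker_of_lt_top _ (lt_top_iff_ne_top.mpr h)
  set x : Fin 4 → L := fun i => f (Pi.single i 1) with hx
  have hfx : ∀ v, f v = x ⬝ᵥ v := by
    intro v
    rw [f.pi_apply_eq_sum_univ v, dotProduct]
    refine Finset.sum_congr rfl fun i _ => ?_
    rw [smul_eq_mul, mul_comm, hx]
    congr 2
    funext j
    simp [Pi.single_apply, eq_comm]
  have hx0 : x ≠ 0 := by
    intro h0
    exact hf0 (LinearMap.ext fun v => by rw [hfx, h0, zero_dotProduct]; rfl)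
  obtain ⟨p, hp⟩ := hyperplaneForm_ne_zero (three_le_finrank_range_hyperplaneForm hm hω hx0)
  apply hp
  have : systemMap K p ∈ systemU K L := range_systemMap K (L := L) ▸ ⟨p, rfl⟩
  have := hf (Submodule.subset_span this)
  rwa [LinearMap.mem_ker, hfx] at this

theorem isSystem_systemU (hm : Module.finrank K L = 4) [CharP L 2]
    (hω : ∀ t : L, t ^ 2 + t + 1 = 0 → φ t = t + 1) : IsSystem K 8 4 (systemU K L) :=
  ⟨finrank_systemU hm, span_systemU hm hω⟩

theorem exists_isAssociated_systemU (hm : Module.finrank K L = 4) :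
    ∃ C : Submodule L (Fin 8 → L), IsAssociated K C (systemU K L) := by
  have := Module.finite_of_finrank_pos (R := K) (M := L) (by omega)
  let b := Module.finBasisOfFinrankEq K (systemU K L) (finrank_systemU hm)
  refine ⟨codeOfColumns fun j => (b j : Fin 4 → L), isAssociated_codeOfColumns ?_⟩
  have : Set.range (fun j => (b j : Fin 4 → L)) = (systemU K L).subtype '' Set.range b := by
    rw [← Set.range_comp]; rfl
  rw [this, ← Submodule.map_span, b.span_eq, Submodule.map_subtype_top]

section Columns

variable {n : ℕ} {g : Fin n → Fin 4 → L}

theorem exists_linearCombination_eq_systemMap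
    (hg : Submodule.span K (Set.range g) = systemU K L) (p : L × L) :
    ∃ κ, Fintype.linearCombination K g κ = systemMap K p := by
  have : systemMap K p ∈ LinearMap.range (Fintype.linearCombination K g) := by
    rw [Fintype.range_linearCombination, hg, ← range_systemMap]
    exact ⟨p, rfl⟩
  exact this

theorem exists_systemMap_eq_linearCombination
    (hg : Submodule.span K (Set.range g) = systemU K L) (κ : Fin n → K) :
    ∃ p, systemMap K p = Fintype.linearCombination K g κ := by
  have : Fintype.linearCombination K g κ ∈ LinearMap.range (systemMap K (L := L)) := by
    rw [range_systemMap, ← hg, ← Fintype.range_linearCombination K]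
    exact ⟨κ, rfl⟩
  exact this

theorem rankWeight_dotProduct (hg : Submodule.span K (Set.range g) = systemU K L)
    (x : Fin 4 → L) : rankWeight K (fun j => x ⬝ᵥ g j) =
      Module.finrank K (LinearMap.range (hyperplaneForm K x)) := by
  rw [rankWeight_eq_finrank_range]
  have : LinearMap.range (Fintype.linearCombination K (fun j => x ⬝ᵥ g j)) =
      LinearMap.range (hyperplaneForm K x) := by
    ext z
    constructor
    · rintro ⟨κ, rfl⟩
      obtain ⟨p, hp⟩ := exists_systemMap_eq_linearCombination hg κ
      exact ⟨p, by rw [linearCombination_dotProduct, ← hp]; rfl⟩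
    · rintro ⟨p, rfl⟩
      obtain ⟨κ, hκ⟩ := exists_linearCombination_eq_systemMap hg p
      exact ⟨κ, by rw [linearCombination_dotProduct, hκ]; rfl⟩
  rw [this]

theorem ker_hyperplaneForm_le_of_rankSupport_le
    (hg : Submodule.span K (Set.range g) = systemU K L) {x y : Fin 4 → L}
    (h : rankSupport K (fun j => y ⬝ᵥ g j) ≤ rankSupport K (fun j => x ⬝ᵥ g j)) :
    LinearMap.ker (hyperplaneForm K x) ≤ LinearMap.ker (hyperplaneForm K y) := by
  rw [rankSupport_le_iff] at h
  intro p hp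
  obtain ⟨κ, hκ⟩ := exists_linearCombination_eq_systemMap hg p
  have h' := h (show κ ∈ LinearMap.ker _ by
    rw [LinearMap.mem_ker, linearCombination_dotProduct, hκ]; exact hp)
  rwa [LinearMap.mem_ker, linearCombination_dotProduct, hκ] at h'

end Columns

theorem three_le_rankWeight_of_isAssociated (hm : Module.finrank K L = 4) [CharP L 2]
    (hω : ∀ t : L, t ^ 2 + t + 1 = 0 → φ t = t + 1) {n : ℕ} {C : Submodule L (Fin n → L)}
    (hC : IsAssociated K C (systemU K L)) {c : Fin n → L} (hc : c ∈ C) (h0 : c ≠ 0) :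
    3 ≤ rankWeight K c := by
  obtain ⟨g, hg, rfl⟩ := hC.exists_columns
  obtain ⟨x, rfl⟩ := (mem_codeOfColumns g c).mp hc
  rw [rankWeight_dotProduct hg]
  refine three_le_finrank_range_hyperplaneForm hm hω ?_
  rintro rfl
  exact h0 (by funext j; simp)

theorem isMinimalCode_of_isAssociated (hm : Module.finrank K L = 4) [CharP L 2]
    (hω : ∀ t : L, t ^ 2 + t + 1 = 0 → φ t = t + 1) {n : ℕ} {C : Submodule L (Fin n → L)}
    (hC : IsAssociated K C (systemU K L)) : IsMinimalCode K C := by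
  obtain ⟨g, hg, rfl⟩ := hC.exists_columns
  intro v hv hv0 u hu
  obtain ⟨x, rfl⟩ := (mem_codeOfColumns g v).mp hv
  obtain ⟨y, rfl⟩ := (mem_codeOfColumns g u).mp hu
  constructor
  · intro h
    obtain ⟨c, rfl⟩ := exists_smul_of_ker_hyperplaneForm_le hm hω (x := x)
      (by rintro rfl; exact hv0 (by funext j; simp)) (ker_hyperplaneForm_le_of_rankSupport_le hg h)
    exact ⟨c, by funext j; simp⟩
  · rintro ⟨c, hc⟩
    rw [hc]
    exact rankSupport_smul_le c _

theorem finrank_of_isAssociated (hm : Module.finrank K L = 4) [CharP L 2]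
    (hω : ∀ t : L, t ^ 2 + t + 1 = 0 → φ t = t + 1) {n : ℕ} {C : Submodule L (Fin n → L)}
    (hC : IsAssociated K C (systemU K L)) : Module.finrank L C = 4 := by
  obtain ⟨g, hg, rfl⟩ := hC.exists_columns
  let f : (Fin 4 → L) →ₗ[L] Fin n → L :=
    { toFun := fun x j => x ⬝ᵥ g j
      map_add' := fun x y => by funext j; simp [add_dotProduct]
      map_smul' := fun c x => by funext j; simp }
  have hf : Function.Injective f := by
    rw [← LinearMap.ker_eq_bot, LinearMap.ker_eq_bot']
    intro x hx
    by_contra h0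
    obtain ⟨p, hp⟩ := hyperplaneForm_ne_zero (three_le_finrank_range_hyperplaneForm hm hω h0)
    obtain ⟨κ, hκ⟩ := exists_linearCombination_eq_systemMap hg p
    apply hp
    change x ⬝ᵥ systemMap K p = 0
    rw [← hκ, ← linearCombination_dotProduct]
    change Fintype.linearCombination K (f x) κ = 0
    rw [hx]
    simp [Fintype.linearCombination_apply]
  have hr : codeOfColumns g = LinearMap.range f := by
    ext v
    rw [mem_codeOfColumns]
    exact exists_congr fun x => eq_comm
  rw [hr, LinearMap.finrank_range_of_inj hf, Module.finrank_fin_fun]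

theorem isMRD_of_isAssociated (hm : Module.finrank K L = 4) [CharP L 2]
    (hω : ∀ t : L, t ^ 2 + t + 1 = 0 → φ t = t + 1) {C : Submodule L (Fin 8 → L)}
    (hC : IsAssociated K C (systemU K L)) : IsMRD K 8 4 C := by
  have hd : minDist K C = 3 := by
    obtain ⟨g, hg, hCg⟩ := hC.exists_columns
    obtain ⟨x, hx, hxr⟩ := exists_finrank_range_hyperplaneForm_le (K := K) (L := L) hm
    have h3 := three_le_finrank_range_hyperplaneForm hm hω hx
    have hmem : (fun j => x ⬝ᵥ g j) ∈ C := hCg ▸ (mem_codeOfColumns g _).mpr ⟨x, rfl⟩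
    have hne : (fun j => x ⬝ᵥ g j) ≠ 0 := by
      intro h0
      have := rankWeight_dotProduct hg x
      rw [rankWeight_eq_finrank_range, h0] at this
      have hz : Fintype.linearCombination K (0 : Fin 8 → L) = 0 :=
        LinearMap.ext fun κ => by simp [Fintype.linearCombination_apply]
      rw [hz, LinearMap.range_zero, finrank_bot] at this
      omega
    refine le_antisymm ?_ ?_
    · exact (minDist_le_rankWeight hmem hne).trans (rankWeight_dotProduct hg x ▸ hxr)
    · obtain ⟨c, hc, h0, h⟩ := exists_rankWeight_eq_minDist (K := K)
        (C := C) ((Submodule.ne_bot_iff C).mpr ⟨_, hmem, hne⟩)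
      exact h ▸ three_le_rankWeight_of_isAssociated hm hω hC hc h0
  exact ⟨by norm_num, finrank_of_isAssociated hm hω hC, by rw [hm, hd]; rfl⟩

theorem not_codeEquiv_directSum_of_isAssociated (hm : Module.finrank K L = 4) [CharP L 2]
    (hω : ∀ t : L, t ^ 2 + t + 1 = 0 → φ t = t + 1) {C : Submodule L (Fin 8 → L)}
    (hC : IsAssociated K C (systemU K L)) {t : ℕ} {n k : Fin t → ℕ} (hn : ∑ i, n i = 8)
    (D : (i : Fin t) → Submodule L (Fin (n i) → L)) (hlt : ∀ i, n i < 8)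
    (hD : ∀ i, IsMRD K (n i) (k i) (D i)) : ¬ CodeEquiv K C (directSum hn D) := by
  intro he
  have hS : IsAssociated K (directSum hn D) (systemU K L) := by
    obtain ⟨u, hu, hCu⟩ := hC
    exact ⟨u, hu, hCu.trans he⟩
  obtain ⟨i, hi, hk⟩ := exists_isMRD_four_two_of_directSum hm hn D hlt hD
    (finrank_of_isAssociated hm hω hS)
    fun c hc h0 => three_le_rankWeight_of_isAssociated hm hω hS hc h0
  exact not_isMinimalCode_directSum hm hn D i hi (hk ▸ hD i)
    (isMinimalCode_of_isAssociated hm hω hS)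

end Main

end RankMetric

theorem corollary4p12 {K L : Type*} [Field K] [Fintype K] [Field L] [Algebra K L]
    (hm : Module.finrank K L = 4) :
    (∀ h : ℕ, Odd h → Fintype.card K = 2 ^ h →
      RankMetric.IsSystem K 8 4 (RankMetric.systemU K L) ∧
      (∃ C : Submodule L (Fin 8 → L), RankMetric.IsAssociated K C (RankMetric.systemU K L)) ∧
      ∀ C : Submodule L (Fin 8 → L), RankMetric.IsAssociated K C (RankMetric.systemU K L) →
        RankMetric.IsMRD K 8 4 C ∧
        RankMetric.IsMinimalCode K C ∧
        ∀ (t : ℕ) (n k : Fin t → ℕ) (hn : ∑ i, n i = 8)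
          (D : (i : Fin t) → Submodule L (Fin (n i) → L)),
          (∀ i, n i < 8) → (∀ i, RankMetric.IsMRD K (n i) (k i) (D i)) →
            ¬ RankMetric.CodeEquiv K C (RankMetric.directSum hn D)) ∧
    (∀ D₁ D₂ : Submodule L (Fin 4 → L),
      RankMetric.IsMRD K 4 2 D₁ → RankMetric.IsMRD K 4 2 D₂ →
        ¬ RankMetric.IsMinimalCode K
          (RankMetric.directSum (n := fun _ : Fin 2 => 4) (N := 8) rfl ![D₁, D₂])) := by
  refine ⟨fun h ho hc => ?_, fun D₁ D₂ h₁ _ => ?_⟩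
  · have : CharP L 2 := charP_two_of_card hc
    have hω (t : L) (ht : t ^ 2 + t + 1 = 0) : FiniteField.frobeniusAlgHom K L t = t + 1 :=
      frobenius_eq_add_one ho hc ht
    exact ⟨RankMetric.isSystem_systemU hm hω, RankMetric.exists_isAssociated_systemU hm,
      fun C hC => ⟨RankMetric.isMRD_of_isAssociated hm hω hC,
        RankMetric.isMinimalCode_of_isAssociated hm hω hC,
        fun t n k hn D hlt hD =>
          RankMetric.not_codeEquiv_directSum_of_isAssociated hm hω hC hn D hlt hD⟩⟩
  · exact RankMetric.not_isMinimalCode_directSum hm _ _ 0 rfl h₁
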